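/- Let $\Gamma$ be one of the following graphs, with vertex set $X$ and graph distance $d(\cdot,\cdot)$; each has diameter $d$ as indicated. * The Johnson graph $J(n,k)$, $2k\le n$, $d=k$: vertices are the $k$-subsets of $[n]$, with $x,y$ adjacent iff $|x\cap y|=k-1$. Let $\mathbf L$ be the set of subsets of $[n]$ of size at most $k$ together with $\hat 1=[n]$, ordered by inclusion; the rank is the cardinality, except that $\hat 1$ has rank $k+1$ (if $n>0$). * The Grassmann graph $J_q(n,k)$, $2k\le n$, $d=k$: vertices are the $k$-dimensional subspaces of an $n$-dimensional vector space $V$ over a field with $q$ elements, with $x,y$ adjacent iff $\dim(x\cap y)=k-1$. Let $\mathbf L$ be the set of subspaces of $V$ of dimension at most $k$ together with $\hat 1=V$, ordered by inclusion; the rank is the dimension, except that $\hat 1$ has rank $k+1$ (if $n>0$). * The hypercube $H(n,2)$, $d=n$: vertices are the words in $\{1,-1\}^n$, adjacent iff they differ in exactly one coordinate. Let $\mathbf L$ be the set of pairs $(I,J)$ of disjoint subsets of $[n]$, ordered by $(I,J)\le(I',J')\Leftrightarrow I\subseteq I'$ and $J\subseteq J'$, with an extra greatest element $\hat 1$; the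 rank of $(I,J)$ is $|I|+|J|$ and that of $\hat 1$ is $n+1$. A word $x$ is identified with $(\{i:x_i=1\},\{i:x_i=-1\})$. Let $\Omega_j$ be the set of elements of $\mathbf L$ of rank $j$, so that $X=\Omega_d$. For $z\in\mathbf L$ define $\iota_z\in\mathbb R^X$ by $\iota_z(x)=1$ if $z\le x$ and $\iota_z(x)=0$ otherwise. For $0\le j\le d$ let $\Lambda_j$ be the span of $\{\iota_z: z\in\Omega_j\}$, put $\Lambda_{-1}=0$, and set $V_0=\Lambda_0$ and $V_j=\Lambda_j\cap\Lambda_{j-1}^{\perp}$ for $1\le j\le d$, where $\perp$ refers to $\langle f,g\rangle=\sum_{x\in X}f(x)g(x)$. For $0\le i\le d$ let $A_i$ be the matrix with entries $(A_i)_{xy}=1$ if $d(x,y)=i$ and $0$ otherwise, and let $\mathcal A$ be the adjacency operator on $\mathbb R^X$, $(\mathcal Af)(x)=\sum_{y:\,d(x,y)=1}f(y)$. Write $[i]_q=\frac{q^i-1}{q-1}$. **Theorem.** There are real numbers $\theta_0>\theta_1>\dots>\theta_d$, which are all the eigenvalues of $\mathcal A$, such that: 1. $\mathbb R^X=\bigoplus_{j=0}^d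 V_j$, every $V_j$ is nonzero, $V_0,\dots,V_d$ are the common eigenspaces of $A_0,\dots,A_d$ (that is, there are reals $p_i(j)$ with $V_j=\bigcap_{i=0}^d\ker(A_i-p_i(j))$), and $V_j$ is the full eigenspace of $\mathcal A$ for the eigenvalue $\theta_j$, for $0\le j\le d$. 2. $\mathcal A v-\theta_j v\in\Lambda_{j-1}$ for all $v\in\Lambda_j$ and $0\le j\le d$. 3. For $0\le j<d$ the eigenvalues satisfy $$\theta_j=\begin{cases}\theta_{j+1}+n-2j,&\theta_d=-k\quad\text{for }J(n,k),\\ \theta_{j+1}+[n-2j]_q\,q^j,&\theta_d=-[k]_q\quad\text{for }J_q(n,k),\\ \theta_{j+1}+2,&\theta_d=-n\quad\text{for }H(n,2).\end{cases}$$ -/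

import Mathlib

/-! ### Functions on the vertex set of a finite graph -/

section Graph

variable {X : Type*} [Fintype X]

open Classical in
/-- The `i`-th distance matrix `A_i` of a graph: the entry at `(x, y)` is `[d(x, y) = i]`. -/
noncomputable def distMatrix (G : SimpleGraph X) (i : ℕ) : Matrix X X ℝ :=
  Matrix.of fun x y => if G.dist x y = i then 1 else 0

open Classical in
/-- The adjacency operator `f ↦ (x ↦ ∑_{y : d(x, y) = 1} f y)` on real functions on the vertices. -/
noncomputable def adjacencyOperator (G : SimpleGraph X) : (X → ℝ) →ₗ[ℝ] (X → ℝ) where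
  toFun f := fun x => ∑ y with G.dist x y = 1, f y
  map_add' f g := by
    funext x
    simp [Finset.sum_add_distrib]
  map_smul' c f := by
    funext x
    simp [Finset.mul_sum]

/-- The orthogonal `U^⊥` for the inner product `⟨f, g⟩ = ∑ x, f x * g x` on `X → ℝ`. -/
def orthSubspace (U : Submodule ℝ (X → ℝ)) : Submodule ℝ (X → ℝ) where
  carrier := {f | ∀ g ∈ U, ∑ x, f x * g x = 0}
  add_mem' := by
    intro a b ha hb g hg
    simp [add_mul, Finset.sum_add_distrib, ha g hg, hb g hg]
  zero_mem' := by
    intro g _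
    simp
  smul_mem' := by
    intro c f hf g hg
    simp [mul_assoc, ← Finset.mul_sum, hf g hg]

/-- `W 0, …, W d` are the eigenspaces of the graph `G` of diameter `d`, ordered by decreasing
eigenvalue of the adjacency operator: they are nonzero, they decompose `X → ℝ` as a direct sum,
they are the common eigenspaces of `A_0, …, A_d`, and `W j` is the full eigenspace of the adjacency
operator for the eigenvalue `θ j`, where `θ 0 > θ 1 > ⋯ > θ d` are all the eigenvalues.
(Only the values of `W` and `θ` at indices at most `d` matter.) -/
structure IsOrderedEigenspaces (G : SimpleGraph X) (d : ℕ) (W : ℕ → Submodule ℝ (X → ℝ))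
    (θ : ℕ → ℝ) : Prop where
  isInternal : DirectSum.IsInternal fun j : Fin (d + 1) => W j
  ne_bot : ∀ j ≤ d, W j ≠ ⊥
  common : ∃ p : ℕ → ℕ → ℝ, ∀ j ≤ d,
    W j = ⨅ i ∈ Finset.range (d + 1),
      Module.End.eigenspace (Matrix.mulVecLin (distMatrix G i)) (p i j)
  eq_eigenspace : ∀ j ≤ d, W j = Module.End.eigenspace (adjacencyOperator G) (θ j)
  hasEigenvalue_iff : ∀ μ : ℝ,
    Module.End.HasEigenvalue (adjacencyOperator G) μ ↔ ∃ j ≤ d, μ = θ j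
  strictAnti : ∀ i j, i < j → j ≤ d → θ j < θ i

end Graph

/-! ### The subspaces attached to a ranked lattice over the vertex set

Here `L` is a lattice with rank function `rk`, and `e : X → L` is the identification of the
vertices with elements of `L` (in the cases below, with the coatoms). -/

section Lattice

variable {X L : Type*} [Fintype X] [Lattice L]

open Classical in
/-- The function `ι_z` on the vertices, `ι_z x = [z ≤ x]`. -/
noncomputable def latticeIota (e : X → L) (z : L) : X → ℝ :=
  fun x => if z ≤ e x then 1 else 0

/-- The level `Ω_j` of the lattice. -/
def latticeLevel (rk : L → ℕ) (j : ℕ) : Set L := {z | rk z = j}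

/-- `Λ_j`, the span of the `ι_z` with `z` in the level `Ω_j`. -/
noncomputable def latticeLambda (e : X → L) (rk : L → ℕ) (j : ℕ) : Submodule ℝ (X → ℝ) :=
  Submodule.span ℝ (latticeIota e '' latticeLevel rk j)

/-- `Λ_{j-1}`, where `Λ_{-1} = 0`. -/
noncomputable def latticeLambdaPred (e : X → L) (rk : L → ℕ) : ℕ → Submodule ℝ (X → ℝ)
  | 0 => ⊥
  | j + 1 => latticeLambda e rk j

/-- `V_0 = Λ_0` and `V_j = Λ_j ∩ Λ_{j-1}^⊥` for `j ≥ 1`. -/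
noncomputable def latticeV (e : X → L) (rk : L → ℕ) : ℕ → Submodule ℝ (X → ℝ)
  | 0 => latticeLambda e rk 0
  | j + 1 => latticeLambda e rk (j + 1) ⊓ orthSubspace (latticeLambda e rk j)

/-- `V_0, …, V_d` are the eigenspaces of the graph, in decreasing order of the eigenvalues
`θ_0, …, θ_d`, and the adjacency operator acts on `Λ_j` as `θ_j` modulo `Λ_{j-1}`. -/
def LatticeDescribesEigenspaces (G : SimpleGraph X) (e : X → L) (rk : L → ℕ) (d : ℕ)
    (θ : ℕ → ℝ) : Prop :=
  IsOrderedEigenspaces G d (latticeV e rk) θ ∧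
    ∀ j ≤ d, ∀ v ∈ latticeLambda e rk j,
      adjacencyOperator G v - θ j • v ∈ latticeLambdaPred e rk j

end Lattice

/-! ### The Johnson graph `J(n, k)` -/

/-- The `k`-subsets of an `n`-set. -/
abbrev JohnsonVertex (n k : ℕ) : Type := {s : Finset (Fin n) // s.card = k}

/-- The Johnson graph: `x` and `y` are adjacent when `|x ∩ y| = k - 1`. -/
def johnsonGraph (n k : ℕ) : SimpleGraph (JohnsonVertex n k) where
  Adj x y := (x.1 ∩ y.1).card + 1 = k
  symm := ⟨fun x y h => by rwa [Finset.inter_comm]⟩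
  loopless := ⟨fun x h => by
    have := x.2
    rw [Finset.inter_self] at h
    omega⟩

/-- The subsets of `[n]` of size at most `k`, together with `1̂ = [n]`, ordered by inclusion. -/
abbrev JohnsonLattice (n k : ℕ) : Type :=
  {s : Finset (Fin n) // s.card ≤ k ∨ s = Finset.univ}

instance (n k : ℕ) : Lattice (JohnsonLattice n k) where
  inf x y := ⟨x.1 ∩ y.1, by
    rcases x with ⟨x, hx | rfl⟩
    · exact Or.inl ((Finset.card_le_card Finset.inter_subset_left).trans hx)
    · simpa using y.2⟩
  inf_le_left x y := show x.1 ∩ y.1 ⊆ x.1 from Finset.inter_subset_left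
  inf_le_right x y := show x.1 ∩ y.1 ⊆ y.1 from Finset.inter_subset_right
  le_inf x y z h₁ h₂ := show x.1 ⊆ y.1 ∩ z.1 from Finset.subset_inter h₁ h₂
  sup x y := if h : (x.1 ∪ y.1).card ≤ k then ⟨x.1 ∪ y.1, Or.inl h⟩ else ⟨Finset.univ, Or.inr rfl⟩
  le_sup_left x y := by
    split_ifs with h
    · exact show x.1 ⊆ x.1 ∪ y.1 from Finset.subset_union_left
    · exact Finset.subset_univ x.1
  le_sup_right x y := by
    split_ifs with h
    · exact show y.1 ⊆ x.1 ∪ y.1 from Finset.subset_union_right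
    · exact Finset.subset_univ y.1
  sup_le x y z h₁ h₂ := by
    have hle : x.1 ∪ y.1 ⊆ z.1 := Finset.union_subset h₁ h₂
    split_ifs with h
    · exact hle
    · rcases z with ⟨z, hz | rfl⟩
      · exact absurd ((Finset.card_le_card hle).trans hz) h
      · exact Finset.Subset.refl _

/-- The rank: the cardinality below `1̂`, and `k + 1` at `1̂`. -/
def johnsonRank (n k : ℕ) (z : JohnsonLattice n k) : ℕ :=
  if z.1.card ≤ k then z.1.card else k + 1

/-- The vertices of `J(n, k)` as the elements of rank `k`. -/
def johnsonCoatom (n k : ℕ) (x : JohnsonVertex n k) : JohnsonLattice n k := ⟨x.1, Or.inl x.2.le⟩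

/-! ### The Grassmann graph `J_q(n, k)` -/

section Grassmann

variable (F V : Type*) [Field F] [AddCommGroup V] [Module F V]

/-- The `k`-dimensional subspaces of `V`. -/
abbrev GrassmannVertex (k : ℕ) : Type _ := {U : Submodule F V // Module.finrank F U = k}

noncomputable instance [Finite F] [Module.Finite F V] (k : ℕ) : Fintype (GrassmannVertex F V k) :=
  have : Finite V := Module.finite_of_finite F
  have : Finite (Submodule F V) := Finite.of_injective _ SetLike.coe_injective
  Fintype.ofFinite _

/-- The Grassmann graph: `x` and `y` are adjacent when `dim (x ∩ y) = k - 1`. -/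
def grassmannGraph (k : ℕ) : SimpleGraph (GrassmannVertex F V k) where
  Adj x y := Module.finrank F (x.1 ⊓ y.1 : Submodule F V) + 1 = k
  symm := ⟨fun x y h => by rwa [inf_comm]⟩
  loopless := ⟨fun x h => by
    have := x.2
    rw [inf_idem] at h
    omega⟩

/-- The subspaces of `V` of dimension at most `k`, together with `1̂ = V`, ordered by inclusion. -/
abbrev GrassmannLattice (k : ℕ) : Type _ :=
  {U : Submodule F V // Module.finrank F U ≤ k ∨ U = ⊤}

open Classical in
noncomputable instance [Module.Finite F V] (k : ℕ) : Lattice (GrassmannLattice F V k) where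
  inf x y := ⟨x.1 ⊓ y.1, by
    rcases x with ⟨x, hx | rfl⟩
    · exact Or.inl ((Submodule.finrank_mono inf_le_left).trans hx)
    · rw [top_inf_eq]
      exact y.2⟩
  inf_le_left x y := show x.1 ⊓ y.1 ≤ x.1 from inf_le_left
  inf_le_right x y := show x.1 ⊓ y.1 ≤ y.1 from inf_le_right
  le_inf x y z h₁ h₂ := show x.1 ≤ y.1 ⊓ z.1 from le_inf h₁ h₂
  sup x y := if h : Module.finrank F (x.1 ⊔ y.1 : Submodule F V) ≤ k then ⟨x.1 ⊔ y.1, Or.inl h⟩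
    else ⟨⊤, Or.inr rfl⟩
  le_sup_left x y := by
    split_ifs with h
    · exact show x.1 ≤ x.1 ⊔ y.1 from le_sup_left
    · exact show x.1 ≤ ⊤ from le_top
  le_sup_right x y := by
    split_ifs with h
    · exact show y.1 ≤ x.1 ⊔ y.1 from le_sup_right
    · exact show y.1 ≤ ⊤ from le_top
  sup_le x y z h₁ h₂ := by
    have hle : x.1 ⊔ y.1 ≤ z.1 := sup_le h₁ h₂
    split_ifs with h
    · exact hle
    · rcases z with ⟨z, hz | rfl⟩
      · exact absurd ((Submodule.finrank_mono hle).trans hz) h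
      · exact le_refl (⊤ : Submodule F V)

open Classical in
/-- The rank: the dimension below `1̂`, and `k + 1` at `1̂`. -/
noncomputable def grassmannRank (k : ℕ) (z : GrassmannLattice F V k) : ℕ :=
  if Module.finrank F z.1 ≤ k then Module.finrank F z.1 else k + 1

/-- The vertices of the Grassmann graph as the elements of rank `k`. -/
def grassmannCoatom (k : ℕ) (x : GrassmannVertex F V k) : GrassmannLattice F V k :=
  ⟨x.1, Or.inl x.2.le⟩

end Grassmann

/-- The number `[i]_q = (q ^ i - 1) / (q - 1)`; it is `0` for `i = 0`. It is used for `q ≥ 2`. -/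
noncomputable def qBracket (q i : ℕ) : ℝ := ((q : ℝ) ^ i - 1) / ((q : ℝ) - 1)

/-! ### The hypercube `H(n, 2)` -/

/-- The words of length `n` in the letters `1` and `-1`. -/
abbrev CubeVertex (n : ℕ) : Type := Fin n → ℤˣ

/-- The hypercube: two words are adjacent when they differ in precisely one coordinate. -/
def cubeGraph (n : ℕ) : SimpleGraph (CubeVertex n) where
  Adj x y := hammingDist x y = 1
  symm := ⟨fun x y h => by rwa [hammingDist_comm]⟩
  loopless := ⟨fun x h => by simp at h⟩

/-- The partial words `∑_{i ∈ I} e_i - ∑_{j ∈ J} e_j` with letters `1`, `-1`, `0`, represented by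
the pair `(I, J)` of disjoint subsets of `[n]`, ordered by inclusion in both components. -/
abbrev PartialWord (n : ℕ) : Type :=
  {p : Finset (Fin n) × Finset (Fin n) // Disjoint p.1 p.2}

/-- The partial words, together with an element `1̂` added on top. -/
abbrev CubeLattice (n : ℕ) : Type := WithTop (PartialWord n)

instance (n : ℕ) : SemilatticeInf (PartialWord n) where
  inf x y := ⟨(x.1.1 ∩ y.1.1, x.1.2 ∩ y.1.2),
    x.2.mono Finset.inter_subset_left Finset.inter_subset_left⟩
  inf_le_left x y := show (x.1.1 ∩ y.1.1, x.1.2 ∩ y.1.2) ≤ x.1 from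
    ⟨Finset.inter_subset_left, Finset.inter_subset_left⟩
  inf_le_right x y := show (x.1.1 ∩ y.1.1, x.1.2 ∩ y.1.2) ≤ y.1 from
    ⟨Finset.inter_subset_right, Finset.inter_subset_right⟩
  le_inf x y z h₁ h₂ := show x.1 ≤ (y.1.1 ∩ z.1.1, y.1.2 ∩ z.1.2) from
    ⟨Finset.subset_inter h₁.1 h₂.1, Finset.subset_inter h₁.2 h₂.2⟩

/-- The join of two partial words: union in both components if this is a partial word, and `1̂`
otherwise. -/
def wordSup (n : ℕ) (x y : PartialWord n) : CubeLattice n :=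
  if h : Disjoint (x.1.1 ∪ y.1.1) (x.1.2 ∪ y.1.2) then
    WithTop.some ⟨(x.1.1 ∪ y.1.1, x.1.2 ∪ y.1.2), h⟩
  else ⊤

theorem le_wordSup (n : ℕ) (x y : PartialWord n) :
    WithTop.some x ≤ wordSup n x y ∧ WithTop.some y ≤ wordSup n x y := by
  unfold wordSup
  split_ifs with h
  · have hx : x ≤ (⟨(x.1.1 ∪ y.1.1, x.1.2 ∪ y.1.2), h⟩ : PartialWord n) :=
      show x.1 ≤ (x.1.1 ∪ y.1.1, x.1.2 ∪ y.1.2) from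
        ⟨Finset.subset_union_left, Finset.subset_union_left⟩
    have hy : y ≤ (⟨(x.1.1 ∪ y.1.1, x.1.2 ∪ y.1.2), h⟩ : PartialWord n) :=
      show y.1 ≤ (x.1.1 ∪ y.1.1, x.1.2 ∪ y.1.2) from
        ⟨Finset.subset_union_right, Finset.subset_union_right⟩
    exact ⟨WithTop.coe_le_coe.2 hx, WithTop.coe_le_coe.2 hy⟩
  · exact ⟨le_top, le_top⟩

theorem wordSup_le (n : ℕ) (x y z : PartialWord n) (h₁ : x ≤ z) (h₂ : y ≤ z) :
    wordSup n x y ≤ WithTop.some z := by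
  have h₁' : x.1 ≤ z.1 := h₁
  have h₂' : y.1 ≤ z.1 := h₂
  have hI : x.1.1 ∪ y.1.1 ⊆ z.1.1 := Finset.union_subset h₁'.1 h₂'.1
  have hJ : x.1.2 ∪ y.1.2 ⊆ z.1.2 := Finset.union_subset h₁'.2 h₂'.2
  have h : Disjoint (x.1.1 ∪ y.1.1) (x.1.2 ∪ y.1.2) := z.2.mono hI hJ
  unfold wordSup
  rw [dif_pos h]
  have hle : (⟨(x.1.1 ∪ y.1.1, x.1.2 ∪ y.1.2), h⟩ : PartialWord n) ≤ z :=
    show (x.1.1 ∪ y.1.1, x.1.2 ∪ y.1.2) ≤ z.1 from ⟨hI, hJ⟩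
  exact WithTop.coe_le_coe.2 hle

/-- The join on the whole lattice. -/
def cubeSup (n : ℕ) : CubeLattice n → CubeLattice n → CubeLattice n
  | WithTop.some x, WithTop.some y => wordSup n x y
  | _, _ => ⊤

theorem le_cubeSup (n : ℕ) (x y : CubeLattice n) : x ≤ cubeSup n x y ∧ y ≤ cubeSup n x y := by
  induction x using WithTop.recTopCoe with
  | top => exact ⟨le_top, le_top⟩
  | coe x =>
    induction y using WithTop.recTopCoe with
    | top => exact ⟨le_top, le_top⟩
    | coe y => exact le_wordSup n x y

theorem cubeSup_le (n : ℕ) (x y z : CubeLattice n) (h₁ : x ≤ z) (h₂ : y ≤ z) :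
    cubeSup n x y ≤ z := by
  induction z using WithTop.recTopCoe with
  | top => exact le_top
  | coe z =>
    induction x using WithTop.recTopCoe with
    | top => exact absurd h₁ (WithTop.not_top_le_coe _)
    | coe x =>
      induction y using WithTop.recTopCoe with
      | top => exact absurd h₂ (WithTop.not_top_le_coe _)
      | coe y => exact wordSup_le n x y z (WithTop.coe_le_coe.1 h₁) (WithTop.coe_le_coe.1 h₂)

instance (n : ℕ) : Lattice (CubeLattice n) where
  __ := (inferInstance : SemilatticeInf (CubeLattice n))
  sup := cubeSup n
  le_sup_left x y := (le_cubeSup n x y).1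
  le_sup_right x y := (le_cubeSup n x y).2
  sup_le := cubeSup_le n

/-- The rank: `|I| + |J|` at `(I, J)`, and `n + 1` at `1̂`. -/
def cubeRank (n : ℕ) : CubeLattice n → ℕ
  | WithTop.some z => z.1.1.card + z.1.2.card
  | ⊤ => n + 1

/-- The words as the elements of rank `n`. -/
def cubeCoatom (n : ℕ) (x : CubeVertex n) : CubeLattice n :=
  WithTop.some ⟨(Finset.univ.filter fun i => x i = 1, Finset.univ.filter fun i => x i = -1), by
    rw [Finset.disjoint_filter]
    intro i _ h
    rw [h]
    decide⟩

/-! ### Orthogonal complements in `X → ℝ` -/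

section OrthogonalDecomposition

variable {X : Type*} [Fintype X]

/-! One argument serves all three families; only the counts collected in `LatticeCounts` differ. If
`z` has rank `j`, the number of neighbours `y` of `x` with `z ≤ y` is `θ_j [z ≤ x]` plus `c_j` times
the number of `w` of rank `j - 1` below both `z` and `x`. As functions of `x` this reads `𝒜 ι_z =
θ_j ι_z + c_j ∑ ι_w`, so `𝒜` acts as `θ_j` on `Λ_j` modulo `Λ_{j-1}`. Every `w ≤ x` of rank `j < d`
has the same number `m_j` of covers below `x`, so `Λ_j ⊆ Λ_{j+1}`, and `Λ_d` is the whole space.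
Since `𝒜` is symmetric and preserves `Λ_{j-1}`, it is exactly `θ_j` on `V_j`
(`adjacencyOperator_eq_of_mem_latticeV`). The `V_j` span and the `θ_j` are distinct, so the `V_j`
are the full eigenspaces.

The remaining claims rest on `C_i^y(x)`, the number of `z` of rank `i` below both `x` and `y`
(`commonCount`). It depends only on `d(x, y)`, `C_d^y` is the delta function at `y`, and `𝒜
C_{i+1}^y = θ_{i+1} C_{i+1}^y + c_{i+1} m_i C_i^y`. Descending from `C_d`, each kernel `C_i` acts on
each `V_j` as a scalar; the `A_i` are obtained from these kernels by a unitriangular change of basis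
(`exists_scalar_indicator`). The same recursion shows that no product of `d` factors `𝒜 - t`
vanishes (`prod_ne_zero`), so none of the `d + 1` spaces `V_j` can be zero.

The counts come from swapping one element (Johnson), flipping one coordinate (cube), and enumerating
covers and hyperplanes of subspaces (Grassmann). -/

theorem mem_orthSubspace {U : Submodule ℝ (X → ℝ)} {f : X → ℝ} :
    f ∈ orthSubspace U ↔ ∀ g ∈ U, ∑ x, f x * g x = 0 := Iff.rfl

theorem inf_orthSubspace (U : Submodule ℝ (X → ℝ)) : U ⊓ orthSubspace U = ⊥ := by
  rw [eq_bot_iff]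
  rintro f ⟨hf, hf'⟩
  have h := hf' f hf
  rw [Finset.sum_eq_zero_iff_of_nonneg fun x _ => mul_self_nonneg _] at h
  rw [Submodule.mem_bot]
  funext x
  simpa using h x (Finset.mem_univ x)

/-- For a reflexive form in finite dimension it suffices that a subspace meets its orthogonal
trivially, which is positive definiteness. -/
theorem sup_orthSubspace (U : Submodule ℝ (X → ℝ)) : U ⊔ orthSubspace U = ⊤ := by
  let B : LinearMap.BilinForm ℝ (X → ℝ) := dotProductBilin ℝ ℝ
  have hB : B.IsRefl := fun f g h => by
    change g ⬝ᵥ f = 0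
    rw [dotProduct_comm]
    exact h
  have hU : B.orthogonal U = orthSubspace U := by
    ext f
    rw [LinearMap.BilinForm.mem_orthogonal_iff, mem_orthSubspace]
    refine forall₂_congr fun g _ => ?_
    change g ⬝ᵥ f = 0 ↔ f ⬝ᵥ g = 0
    rw [dotProduct_comm]
  rw [← hU]
  refine ((LinearMap.BilinForm.isCompl_orthogonal_iff_disjoint hB).2 ?_).sup_eq_top
  rw [disjoint_iff, hU, inf_orthSubspace]

theorem eq_sup_inf_orthSubspace {U W : Submodule ℝ (X → ℝ)} (h : U ≤ W) :
    W = U ⊔ W ⊓ orthSubspace U := by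
  rw [inf_comm, ← sup_inf_assoc_of_le _ h, sup_orthSubspace, top_inf_eq]

end OrthogonalDecomposition

/-! ### Full eigenspaces and annihilating products -/

/-- Spaces of eigenvectors for distinct eigenvalues that together span must be the full eigenspaces.
By the modular law, meeting `⊤ = V i ⊔ ⨆ j ≠ i, E j` with `E i` leaves only `V i`. -/
theorem iSupIndep.eq_of_le_of_iSup_eq_top {ι α : Type*} [CompleteLattice α] [IsModularLattice α]
    {V E : ι → α} (hE : iSupIndep E) (hV : ∀ i, V i ≤ E i) (htop : ⨆ i, V i = ⊤) (i : ι) :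
    V i = E i := by
  refine le_antisymm (hV i) ?_
  have h1 : (⊤ : α) ≤ V i ⊔ ⨆ (j) (_ : j ≠ i), E j := by
    rw [← htop]
    refine iSup_le fun j => ?_
    rcases eq_or_ne j i with rfl | hj
    · exact le_sup_left
    · exact (hV j).trans (le_sup_of_le_right (le_iSup₂_of_le j hj le_rfl))
  calc E i = (V i ⊔ ⨆ (j) (_ : j ≠ i), E j) ⊓ E i := by rw [top_le_iff.1 h1, top_inf_eq]
    _ = V i ⊔ (⨆ (j) (_ : j ≠ i), E j) ⊓ E i := sup_inf_assoc_of_le _ (hV i)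
    _ ≤ V i := by rw [inf_comm, (hE i).eq_bot, sup_bot_eq]

/-- The factors to the right of `A - t` only rescale the eigenvector, `A - t` kills it, and the
factors to the left keep it zero. -/
theorem Module.End.prod_map_sub_smul_apply_eq_zero {K M : Type*} [CommRing K] [AddCommGroup M]
    [Module K M] (A : Module.End K M) (l : List K) {t : K}
    (ht : t ∈ l) {v : M} (hv : A v = t • v) :
    (l.map fun t => A - t • (1 : Module.End K M)).prod v = 0 := by
  have happly : ∀ l : List K,
      ∃ s : K, (l.map fun t => A - t • (1 : Module.End K M)).prod v = s • v := by
    intro l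
    induction l with
    | nil => exact ⟨1, by simp⟩
    | cons u l ih =>
      obtain ⟨s, hs⟩ := ih
      refine ⟨s * (t - u), ?_⟩
      rw [List.map_cons, List.prod_cons, Module.End.mul_apply, hs, map_smul, LinearMap.sub_apply,
        LinearMap.smul_apply, Module.End.one_apply, hv]
      module
  induction l with
  | nil => simp at ht
  | cons u l ih =>
    rw [List.map_cons, List.prod_cons, Module.End.mul_apply]
    rcases List.mem_cons.1 ht with rfl | ht
    · obtain ⟨s, hs⟩ := happly l
      rw [hs, map_smul, LinearMap.sub_apply, LinearMap.smul_apply, Module.End.one_apply, hv,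
        sub_self, smul_zero]
    · rw [ih ht, map_zero]

/-- Counting conditions on a ranked lattice above a graph under which the functions `ι_z` describe
the eigenspaces of the graph. -/
structure LatticeCounts {X L : Type*} [Fintype X] [Lattice L] (G : SimpleGraph X) (e : X → L)
    (rk : L → ℕ) (d : ℕ) (θ c m : ℕ → ℝ) (N : ℕ → ℕ → ℝ) : Prop where
  eq_of_dist_eq_zero : ∀ x y, G.dist x y = 0 → x = y
  dist_le : ∀ x y, G.dist x y ≤ d
  exists_dist_eq : ∃ x y, G.dist x y = d
  card_neighbors : ∀ z, rk z ≤ d → ∀ x,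
    ({y | G.dist x y = 1 ∧ z ≤ e y}.ncard : ℝ) = θ (rk z) * latticeIota e z x +
      c (rk z) * {w | rk w + 1 = rk z ∧ w ≤ z ∧ w ≤ e x}.ncard
  card_covers : ∀ w x, rk w < d → w ≤ e x →
    ({z | rk z = rk w + 1 ∧ w ≤ z ∧ z ≤ e x}.ncard : ℝ) = m (rk w)
  card_common : ∀ j ≤ d, ∀ x y,
    ({z | rk z = j ∧ z ≤ e x ∧ z ≤ e y}.ncard : ℝ) = N j (d - G.dist x y)
  common_of_lt : ∀ j r, r < j → N j r = 0
  common_self : ∀ j ≤ d, N j j = 1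
  c_ne_zero : ∀ j < d, c (j + 1) ≠ 0
  m_ne_zero : ∀ j < d, m j ≠ 0
  succ_lt : ∀ j < d, θ (j + 1) < θ j

theorem sum_adjacencyOperator_mul {X : Type*} [Fintype X] (G : SimpleGraph X) (f g : X → ℝ) :
    ∑ x, adjacencyOperator G f x * g x = ∑ x, f x * adjacencyOperator G g x := by
  classical
  simp only [adjacencyOperator, LinearMap.coe_mk, AddHom.coe_mk, Finset.sum_mul, Finset.mul_sum,
    Finset.sum_filter, ite_mul, mul_ite, zero_mul, mul_zero]
  rw [Finset.sum_comm]
  simp only [G.dist_comm]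

theorem mulVecLin_distMatrix_one {X : Type*} [Fintype X] (G : SimpleGraph X) :
    Matrix.mulVecLin (distMatrix G 1) = adjacencyOperator G := by
  classical
  refine LinearMap.ext fun f => funext fun x => ?_
  simp [Matrix.mulVec, dotProduct, distMatrix, adjacencyOperator, Finset.sum_filter]

/-- With `Λ_{-1} = 0`, whose complement is everything, `j = 0` needs no separate treatment. -/
theorem mem_latticeV {X L : Type*} [Fintype X] [Lattice L] {e : X → L} {rk : L → ℕ} {j : ℕ}
    {f : X → ℝ} : f ∈ latticeV e rk j ↔
      f ∈ latticeLambda e rk j ∧ f ∈ orthSubspace (latticeLambdaPred e rk j) := by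
  cases j with
  | zero =>
    refine ⟨fun h => ⟨h, fun g hg => ?_⟩, fun h => h.1⟩
    rw [(Submodule.mem_bot ℝ).1 hg]
    simp
  | succ j => exact Iff.rfl

/-! ### From the counting conditions to the eigenspaces -/

namespace LatticeCounts

variable {X L : Type*} [Lattice L]

theorem iota_mem (e : X → L) (rk : L → ℕ) (z : L) :
    latticeIota e z ∈ latticeLambda e rk (rk z) :=
  Submodule.subset_span ⟨z, rfl, rfl⟩

open Classical in
theorem sum_iota_apply [Fintype L] (e : X → L) (p : L → Prop) [DecidablePred p] (x : X) :
    (∑ z with p z, latticeIota e z) x = ({z | p z ∧ z ≤ e x}.ncard : ℝ) := by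
  rw [Finset.sum_apply, Set.ncard_eq_toFinset_card']
  simp [latticeIota, Finset.filter_filter]

/-- The function `x ↦ |{z : rk z = j, z ≤ x, z ≤ y}|`. -/
noncomputable def commonCount (e : X → L) (rk : L → ℕ) (j : ℕ) (y : X) : X → ℝ :=
  fun x => {z | rk z = j ∧ z ≤ e x ∧ z ≤ e y}.ncard

open Classical in
theorem commonCount_eq_sum [Fintype L] (e : X → L) (rk : L → ℕ) (j : ℕ) (y : X) :
    commonCount e rk j y = ∑ z with rk z = j, latticeIota e z y • latticeIota e z := by
  funext x
  rw [commonCount, Set.ncard_eq_toFinset_card', Finset.sum_apply]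
  simp only [latticeIota, Pi.smul_apply, smul_eq_mul, mul_ite, mul_one, mul_zero]
  simp only [← ite_and, Finset.sum_filter, Set.toFinset_ofPred, Finset.card_filter, Nat.cast_sum,
    Nat.cast_ite, Nat.cast_one, Nat.cast_zero]

theorem commonCount_mem [Finite L] (e : X → L) (rk : L → ℕ) (j : ℕ) (y : X) :
    commonCount e rk j y ∈ latticeLambda e rk j := by
  classical
  have := Fintype.ofFinite L
  rw [commonCount_eq_sum]
  refine Submodule.sum_mem _ fun z hz => Submodule.smul_mem _ _ ?_
  rw [← (Finset.mem_filter.1 hz).2]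
  exact iota_mem e rk z

variable [Fintype X] {G : SimpleGraph X} {e : X → L}
  {rk : L → ℕ} {d : ℕ} {θ c m : ℕ → ℝ} {N : ℕ → ℕ → ℝ}

-- This is `card_neighbors` read as an identity between functions of `x`.
open Classical in
theorem adjacencyOperator_iota [Fintype L] (h : LatticeCounts G e rk d θ c m N) (z : L)
    (hz : rk z ≤ d) : adjacencyOperator G (latticeIota e z) = θ (rk z) • latticeIota e z +
      c (rk z) • ∑ w with rk w + 1 = rk z ∧ w ≤ z, latticeIota e w := by
  funext x
  rw [Pi.add_apply, Pi.smul_apply, Pi.smul_apply, sum_iota_apply, smul_eq_mul, smul_eq_mul]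
  simp only [and_assoc]
  rw [← h.card_neighbors z hz x, Set.ncard_eq_toFinset_card']
  simp [adjacencyOperator, latticeIota, Finset.filter_filter]

open Classical in
theorem sum_iota_covers [Fintype L] (h : LatticeCounts G e rk d θ c m N) (w : L)
    (hw : rk w < d) :
    ∑ z with rk z = rk w + 1 ∧ w ≤ z, latticeIota e z = m (rk w) • latticeIota e w := by
  funext x
  rw [sum_iota_apply, Pi.smul_apply, smul_eq_mul, latticeIota]
  simp only [and_assoc]
  split_ifs with hx
  · rw [h.card_covers w x hw hx, mul_one]
  · have : {z | rk z = rk w + 1 ∧ w ≤ z ∧ z ≤ e x} = ∅ :=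
      Set.eq_empty_of_forall_notMem fun z hz => hx (hz.2.1.trans hz.2.2)
    rw [this]
    simp

theorem latticeLambda_le_succ [Finite L] (h : LatticeCounts G e rk d θ c m N) {j : ℕ}
    (hj : j < d) : latticeLambda e rk j ≤ latticeLambda e rk (j + 1) := by
  classical
  have := Fintype.ofFinite L
  refine Submodule.span_le.2 ?_
  rintro _ ⟨w, rfl, rfl⟩
  have hw : latticeIota e w = (m (rk w))⁻¹ •
      ∑ z with rk z = rk w + 1 ∧ w ≤ z, latticeIota e z := by
    rw [h.sum_iota_covers w hj, smul_smul, inv_mul_cancel₀ (h.m_ne_zero _ hj), one_smul]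
  rw [SetLike.mem_coe, hw]
  refine Submodule.smul_mem _ _ (Submodule.sum_mem _ fun z hz => ?_)
  rw [← (Finset.mem_filter.1 hz).2.1]
  exact iota_mem e rk z

theorem latticeLambdaPred_le [Finite L] (h : LatticeCounts G e rk d θ c m N) {j : ℕ}
    (hj : j ≤ d) : latticeLambdaPred e rk j ≤ latticeLambda e rk j := by
  cases j with
  | zero => exact bot_le
  | succ j => exact h.latticeLambda_le_succ hj

theorem adjacencyOperator_sub_mem [Finite L] (h : LatticeCounts G e rk d θ c m N) {j : ℕ}
    (hj : j ≤ d) {v : X → ℝ} (hv : v ∈ latticeLambda e rk j) :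
    adjacencyOperator G v - θ j • v ∈ latticeLambdaPred e rk j := by
  classical
  have := Fintype.ofFinite L
  suffices latticeLambda e rk j ≤ (latticeLambdaPred e rk j).comap
      (adjacencyOperator G - θ j • LinearMap.id) from this hv
  refine Submodule.span_le.2 ?_
  rintro _ ⟨z, rfl, rfl⟩
  rw [SetLike.mem_coe, Submodule.mem_comap, LinearMap.sub_apply, LinearMap.smul_apply,
    LinearMap.id_apply, h.adjacencyOperator_iota z hj, add_sub_cancel_left]
  refine Submodule.smul_mem _ _ (Submodule.sum_mem _ fun w hw => ?_)
  rw [← (Finset.mem_filter.1 hw).2.1]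
  exact iota_mem e rk w

theorem adjacencyOperator_mem_latticeLambda [Finite L] (h : LatticeCounts G e rk d θ c m N)
    {j : ℕ} (hj : j ≤ d) {v : X → ℝ} (hv : v ∈ latticeLambda e rk j) :
    adjacencyOperator G v ∈ latticeLambda e rk j := by
  have := h.latticeLambdaPred_le hj (h.adjacencyOperator_sub_mem hj hv)
  simpa using Submodule.add_mem _ this (Submodule.smul_mem _ (θ j) hv)

theorem adjacencyOperator_mem_latticeLambdaPred [Finite L]
    (h : LatticeCounts G e rk d θ c m N) {j : ℕ} (hj : j ≤ d) {v : X → ℝ}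
    (hv : v ∈ latticeLambdaPred e rk j) : adjacencyOperator G v ∈ latticeLambdaPred e rk j := by
  cases j with
  | zero =>
    rw [(Submodule.mem_bot ℝ).1 hv, map_zero]
    exact Submodule.zero_mem _
  | succ j => exact h.adjacencyOperator_mem_latticeLambda (by omega) hv

/-- The error `𝒜 v - θ_j v` lies in `Λ_{j-1}`. It is also orthogonal to `Λ_{j-1}`, because `𝒜` is
symmetric and preserves `Λ_{j-1}`. Hence it is zero. -/
theorem adjacencyOperator_eq_of_mem_latticeV [Finite L] (h : LatticeCounts G e rk d θ c m N)
    {j : ℕ} (hj : j ≤ d) {v : X → ℝ} (hv : v ∈ latticeV e rk j) :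
    adjacencyOperator G v = θ j • v := by
  have hv' := mem_latticeV.1 hv
  have h1 : adjacencyOperator G v - θ j • v ∈ latticeLambdaPred e rk j :=
    h.adjacencyOperator_sub_mem hj hv'.1
  have h2 : adjacencyOperator G v - θ j • v ∈ orthSubspace (latticeLambdaPred e rk j) := by
    refine Submodule.sub_mem _ (fun g hg => ?_) (Submodule.smul_mem _ _ hv'.2)
    rw [sum_adjacencyOperator_mul]
    exact hv'.2 _ (h.adjacencyOperator_mem_latticeLambdaPred hj hg)
  have h3 := (inf_orthSubspace (latticeLambdaPred e rk j)).le ⟨h1, h2⟩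
  exact sub_eq_zero.1 ((Submodule.mem_bot ℝ).1 h3)

theorem commonCount_apply (h : LatticeCounts G e rk d θ c m N) {j : ℕ} (hj : j ≤ d) (x y : X) :
    commonCount e rk j y x = N j (d - G.dist x y) := h.card_common j hj x y

open Classical in
theorem commonCount_diameter (h : LatticeCounts G e rk d θ c m N) (y : X) :
    commonCount e rk d y = Pi.single y 1 := by
  funext x
  rw [h.commonCount_apply le_rfl]
  rcases eq_or_ne x y with rfl | hxy
  · simp [h.common_self d le_rfl]
  · have := h.dist_le x y
    have h0 : G.dist x y ≠ 0 := fun h0 => hxy (h.eq_of_dist_eq_zero x y h0)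
    rw [h.common_of_lt _ _ (by omega), Pi.single_eq_of_ne hxy]

theorem latticeLambda_diameter [Finite L] (h : LatticeCounts G e rk d θ c m N) :
    latticeLambda e rk d = ⊤ := by
  classical
  rw [eq_top_iff]
  intro f _
  rw [← Finset.univ_sum_single f]
  refine Submodule.sum_mem _ fun y _ => ?_
  have := Submodule.smul_mem _ (f y) (commonCount_mem e rk d y)
  rw [h.commonCount_diameter, ← Pi.single_smul, smul_eq_mul, mul_one] at this
  exact this

theorem latticeLambda_le_iSup [Finite L] (h : LatticeCounts G e rk d θ c m N) {j : ℕ}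
    (hj : j ≤ d) : latticeLambda e rk j ≤ ⨆ i : Fin (d + 1), latticeV e rk i := by
  induction j with
  | zero => exact le_iSup (fun i : Fin (d + 1) => latticeV e rk i) ⟨0, by omega⟩
  | succ j ih =>
    rw [eq_sup_inf_orthSubspace (h.latticeLambda_le_succ hj)]
    exact sup_le (ih (by omega))
      (le_iSup (fun i : Fin (d + 1) => latticeV e rk i) ⟨j + 1, by omega⟩)

theorem iSup_latticeV [Finite L] (h : LatticeCounts G e rk d θ c m N) :
    ⨆ i : Fin (d + 1), latticeV e rk i = ⊤ := by
  rw [eq_top_iff, ← h.latticeLambda_diameter]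
  exact h.latticeLambda_le_iSup le_rfl

/-- This recursion between consecutive levels drives both the scalar action of the distance matrices
and the nonvanishing of the `V_j`. -/
theorem adjacencyOperator_commonCount [Finite L] (h : LatticeCounts G e rk d θ c m N) {j : ℕ}
    (hj : j < d) (y : X) : adjacencyOperator G (commonCount e rk (j + 1) y) =
      θ (j + 1) • commonCount e rk (j + 1) y + (c (j + 1) * m j) • commonCount e rk j y := by
  classical
  have := Fintype.ofFinite L
  have key : ∑ z with rk z = j + 1, latticeIota e z y •
      ∑ w with rk w + 1 = rk z ∧ w ≤ z, latticeIota e w = m j • commonCount e rk j y := by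
    rw [commonCount_eq_sum, Finset.smul_sum]
    simp only [Finset.smul_sum]
    -- Once `w` is summed last, the inner sum of `ι_z(y)` over the covers `z` of `w` is `m j *
    -- ι_w(y)`.
    rw [Finset.sum_comm' (t' := Finset.univ.filter fun w => rk w = j)
      (s' := fun w => Finset.univ.filter fun z => rk z = rk w + 1 ∧ w ≤ z)]
    · refine Finset.sum_congr rfl fun w hw => ?_
      have hw : rk w = j := (Finset.mem_filter.1 hw).2
      have := congrFun (h.sum_iota_covers w (by omega)) y
      rw [Finset.sum_apply, Pi.smul_apply] at this
      rw [← Finset.sum_smul, this, hw, smul_eq_mul, mul_smul]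
    · intro z w
      simp only [Finset.mem_filter, Finset.mem_univ, true_and]
      constructor
      · rintro ⟨h1, h2, h3⟩
        exact ⟨⟨h2.symm, h3⟩, by omega⟩
      · rintro ⟨⟨h1, h2⟩, h3⟩
        exact ⟨by omega, h1.symm, h2⟩
  rw [mul_smul, ← key, commonCount_eq_sum, map_sum, Finset.smul_sum, Finset.smul_sum,
    ← Finset.sum_add_distrib]
  refine Finset.sum_congr rfl fun z hz => ?_
  have hz : rk z = j + 1 := (Finset.mem_filter.1 hz).2
  rw [map_smul, h.adjacencyOperator_iota z (by omega), hz]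
  module

theorem strictAntiOn (h : LatticeCounts G e rk d θ c m N) {i j : ℕ} (hij : i < j)
    (hj : j ≤ d) : θ j < θ i := by
  induction j, hij using Nat.le_induction with
  | base => exact h.succ_lt i hj
  | succ j hij ih => exact (h.succ_lt j hj).trans (ih (by omega))

theorem injective_eigenvalues (h : LatticeCounts G e rk d θ c m N) :
    Function.Injective fun i : Fin (d + 1) => θ i := by
  intro i j hij
  rcases lt_trichotomy i j with hlt | heq | hgt
  · exact absurd hij (h.strictAntiOn hlt (by omega)).ne'
  · exact heq
  · exact absurd hij (h.strictAntiOn hgt (by omega)).ne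

/-- A sum over the vertices with a kernel depending only on the distance acts on each `V_j` as a
scalar. -/
theorem exists_scalar_commonCount [Finite L] (h : LatticeCounts G e rk d θ c m N) {j : ℕ}
    (hj : j ≤ d) {i : ℕ} (hi : i ≤ d) :
    ∃ s : ℝ, ∀ v ∈ latticeV e rk j, ∑ y, v y • commonCount e rk i y = s • v := by
  classical
  induction hn : d - i generalizing i with
  | zero =>
    obtain rfl : i = d := by omega
    refine ⟨1, fun v _ => ?_⟩
    simp only [h.commonCount_diameter, ← Pi.single_smul, smul_eq_mul, mul_one, one_smul]
    exact Finset.univ_sum_single v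
  | succ n ih =>
    obtain ⟨s, hs⟩ := ih (i := i + 1) (by omega) (by omega)
    have hne : c (i + 1) * m i ≠ 0 :=
      mul_ne_zero (h.c_ne_zero i (by omega)) (h.m_ne_zero i (by omega))
    refine ⟨(c (i + 1) * m i)⁻¹ * (s * (θ j - θ (i + 1))), fun v hv => ?_⟩
    have h1 : (c (i + 1) * m i) • ∑ y, v y • commonCount e rk i y =
        (s * (θ j - θ (i + 1))) • v := by
      -- Apply `𝒜` to the identity at level `i + 1`: the right side becomes `s θ_j v`, the left side
      -- acquires the level `i` sum with factor `c (i + 1) * m i`, and that sum can be solved for.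
      have h2 := congrArg (adjacencyOperator G) (hs v hv)
      simp only [map_sum, map_smul, h.adjacencyOperator_commonCount (show i < d by omega),
        h.adjacencyOperator_eq_of_mem_latticeV hj hv, smul_add, Finset.sum_add_distrib] at h2
      simp only [smul_comm _ (θ (i + 1)), smul_comm _ (c (i + 1) * m i), ← Finset.smul_sum,
        hs v hv] at h2
      rw [eq_sub_of_add_eq' h2]
      module
    rw [mul_smul, ← h1, smul_smul, inv_mul_cancel₀ hne, one_smul]

/-- Here `r` stands for `d - dist`. The kernel `C_r` is the indicator of `r` plus a combination of
the indicators of `t > r`, since `N r r = 1` and `N r t = 0` for `t < r`. So the indicators are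
solved for from `r = d` downwards. -/
theorem exists_scalar_indicator [Finite L] (h : LatticeCounts G e rk d θ c m N) {j : ℕ}
    (hj : j ≤ d) {r : ℕ} (hr : r ≤ d) :
    ∃ s : ℝ, ∀ v ∈ latticeV e rk j, ∀ x,
      ∑ y, (if d - G.dist x y = r then 1 else 0) * v y = s * v x := by
  induction hn : d - r using Nat.strong_induction_on generalizing r with
  | _ n ih =>
    have ih' : ∀ t : ℕ, ∃ s : ℝ, r < t → t ≤ d → ∀ v ∈ latticeV e rk j, ∀ x,
        ∑ y, (if d - G.dist x y = t then 1 else 0) * v y = s * v x := by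
      intro t
      by_cases ht : r < t ∧ t ≤ d
      · obtain ⟨s, hs⟩ := ih (d - t) (by omega) ht.2 rfl
        exact ⟨s, fun _ _ => hs⟩
      · exact ⟨0, fun h1 h2 => absurd ⟨h1, h2⟩ ht⟩
    choose s hs using ih'
    obtain ⟨s₀, hs₀⟩ := h.exists_scalar_commonCount hj hr
    refine ⟨s₀ - ∑ t ∈ Finset.Ioc r d, N r t * s t, fun v hv x => ?_⟩
    have h1 := congrFun (hs₀ v hv) x
    rw [Finset.sum_apply] at h1
    simp only [Pi.smul_apply, smul_eq_mul, h.commonCount_apply hr] at h1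
    have h2 : ∀ u ≤ d, N r u = (if u = r then 1 else 0) +
        ∑ t ∈ Finset.Ioc r d, N r t * (if u = t then 1 else 0) := by
      intro u hu
      simp only [mul_ite, mul_one, mul_zero, Finset.sum_ite_eq, Finset.mem_Ioc]
      rcases lt_trichotomy u r with hur | rfl | hur
      · rw [h.common_of_lt _ _ hur, if_neg (by omega), if_neg (by omega), add_zero]
      · simp [h.common_self _ hr]
      · rw [if_neg (by omega), if_pos ⟨hur, hu⟩, zero_add]
    have h3 : ∀ y, v y * N r (d - G.dist x y) = (if d - G.dist x y = r then 1 else 0) * v y +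
        ∑ t ∈ Finset.Ioc r d, N r t * ((if d - G.dist x y = t then 1 else 0) * v y) := by
      intro y
      rw [h2 _ (Nat.sub_le _ _), mul_add, mul_comm, Finset.mul_sum]
      congr 1
      exact Finset.sum_congr rfl fun t _ => by ring
    simp only [h3, Finset.sum_add_distrib] at h1
    rw [Finset.sum_comm] at h1
    have h4 : ∑ t ∈ Finset.Ioc r d,
        ∑ y, N r t * ((if d - G.dist x y = t then 1 else 0) * v y) =
        (∑ t ∈ Finset.Ioc r d, N r t * s t) * v x := by
      rw [Finset.sum_mul]
      refine Finset.sum_congr rfl fun t ht => ?_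
      have ht := Finset.mem_Ioc.1 ht
      rw [← Finset.mul_sum, hs t ht.1 ht.2 v hv x, mul_assoc]
    rw [h4] at h1
    linarith

theorem exists_scalar_distMatrix [Finite L] (h : LatticeCounts G e rk d θ c m N) {j : ℕ}
    (hj : j ≤ d) {i : ℕ} (hi : i ≤ d) :
    ∃ s : ℝ, ∀ v ∈ latticeV e rk j, Matrix.mulVecLin (distMatrix G i) v = s • v := by
  obtain ⟨s, hs⟩ := h.exists_scalar_indicator hj (Nat.sub_le d i)
  refine ⟨s, fun v hv => funext fun x => ?_⟩
  rw [Pi.smul_apply, smul_eq_mul, ← hs v hv x]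
  refine Finset.sum_congr rfl fun y _ => ?_
  have := h.dist_le x y
  simp only [distMatrix, Matrix.of_apply]
  congr 1
  exact if_congr (by omega) rfl rfl

/-- Applying `k` factors `𝒜 - a` to `δ_y`, the function `x ↦ |{z : rk z = d, z ≤ x, z ≤ y}|`,
gives a combination of the functions of rank at least `d - k`, with nonzero lowest coefficient. -/
theorem exists_prod_apply_single [Finite L] (h : LatticeCounts G e rk d θ c m N) (y : X)
    (l : List ℝ) (hl : l.length ≤ d) :
    ∃ a : ℝ, a ≠ 0 ∧
      (l.map fun t => adjacencyOperator G - t • (1 : Module.End ℝ (X → ℝ))).prod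
        (commonCount e rk d y) - a • commonCount e rk (d - l.length) y ∈
      Submodule.span ℝ ((fun i => commonCount e rk i y) '' Set.Ioc (d - l.length) d) := by
  induction l with
  | nil => exact ⟨1, one_ne_zero, by simp⟩
  | cons t l ih =>
    rw [List.length_cons] at hl
    obtain ⟨a, ha, hmem⟩ := ih (by omega)
    set k := d - l.length with hk
    obtain ⟨i, hi⟩ : ∃ i, k = i + 1 := ⟨k - 1, by omega⟩
    have hik : d - (t :: l).length = i := by
      rw [List.length_cons]
      omega
    have hid : i < d := by omega
    rw [hik]
    -- Applying `𝒜 - t` to `a C_{i+1}` gives the new lowest term `a c_{i+1} m_i C_i`; the multiple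
    -- of `C_{i+1}` left over lies in the span of the higher levels.
    refine ⟨a * (c (i + 1) * m i), mul_ne_zero ha
      (mul_ne_zero (h.c_ne_zero i hid) (h.m_ne_zero i hid)), ?_⟩
    set S := Submodule.span ℝ ((fun i => commonCount e rk i y) '' Set.Ioc i d) with hS
    have hgen : ∀ i', i < i' → i' ≤ d → commonCount e rk i' y ∈ S := fun i' h1 h2 =>
      Submodule.subset_span ⟨i', ⟨h1, h2⟩, rfl⟩
    set T := adjacencyOperator G - t • (1 : Module.End ℝ (X → ℝ)) with hT
    have hstep : Submodule.span ℝ ((fun i => commonCount e rk i y) '' Set.Ioc k d) ≤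
        S.comap T := by
      refine Submodule.span_le.2 ?_
      rintro _ ⟨i', ⟨h1, h2⟩, rfl⟩
      obtain ⟨i'', rfl⟩ : ∃ i'', i' = i'' + 1 := ⟨i' - 1, by omega⟩
      simp only [hT, SetLike.mem_coe, Submodule.mem_comap, LinearMap.sub_apply,
        LinearMap.smul_apply, Module.End.one_apply,
        h.adjacencyOperator_commonCount (show i'' < d by omega)]
      have m1 := hgen (i'' + 1) (by omega) (by omega)
      have m2 := hgen i'' (by omega) (by omega)
      exact Submodule.sub_mem _ (Submodule.add_mem _ (Submodule.smul_mem _ _ m1)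
        (Submodule.smul_mem _ _ m2)) (Submodule.smul_mem _ _ m1)
    have h1 := hstep hmem
    rw [Submodule.mem_comap, map_sub, map_smul, hi] at h1
    have h2 : T (commonCount e rk (i + 1) y) = (θ (i + 1) - t) • commonCount e rk (i + 1) y +
        (c (i + 1) * m i) • commonCount e rk i y := by
      simp only [hT, LinearMap.sub_apply, LinearMap.smul_apply, Module.End.one_apply,
        h.adjacencyOperator_commonCount hid]
      module
    rw [h2] at h1
    rw [List.map_cons, List.prod_cons, Module.End.mul_apply]
    have h3 := Submodule.add_mem _ h1
      (Submodule.smul_mem _ (a * (θ (i + 1) - t)) (hgen (i + 1) (by omega) (by omega)))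
    convert h3 using 1
    module

/-- Apply the product to the delta function at `y` and evaluate at `x` with `d(x, y) = d`. There
`C_i^y` vanishes for `i > 0` while `C_0^y` is `1`, so the value is the nonzero lowest coefficient.
-/
theorem prod_ne_zero [Finite L] (h : LatticeCounts G e rk d θ c m N) (l : List ℝ)
    (hl : l.length = d) :
    (l.map fun t => adjacencyOperator G - t • (1 : Module.End ℝ (X → ℝ))).prod ≠ 0 := by
  intro h0
  obtain ⟨x, y, hxy⟩ := h.exists_dist_eq
  obtain ⟨a, ha, hmem⟩ := h.exists_prod_apply_single y l hl.le
  rw [h0, hl, Nat.sub_self, LinearMap.zero_apply, zero_sub] at hmem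
  have hle : Submodule.span ℝ ((fun i => commonCount e rk i y) '' Set.Ioc 0 d) ≤
      LinearMap.ker (LinearMap.proj x : (X → ℝ) →ₗ[ℝ] ℝ) := by
    refine Submodule.span_le.2 ?_
    rintro _ ⟨i, ⟨h1, h2⟩, rfl⟩
    rw [SetLike.mem_coe, LinearMap.mem_ker, LinearMap.proj_apply]
    beta_reduce
    rw [h.commonCount_apply h2, hxy,
      h.common_of_lt _ _ (by omega)]
  have h1 := hle hmem
  rw [LinearMap.mem_ker, LinearMap.proj_apply, Pi.neg_apply, Pi.smul_apply,
    h.commonCount_apply (Nat.zero_le d), hxy, Nat.sub_self, h.common_self 0 (Nat.zero_le d)] at h1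
  simp [ha] at h1

/-- If `V_j` were zero, the other `V_i` would span, and the product of the `d` factors `𝒜 - θ_i`
with `i ≠ j` would be zero. -/
theorem latticeV_ne_bot [Finite L] (h : LatticeCounts G e rk d θ c m N) {j : ℕ} (hj : j ≤ d) :
    latticeV e rk j ≠ ⊥ := by
  intro hbot
  let l : List ℝ := ((List.range (d + 1)).erase j).map θ
  have hl : l.length = d := by
    rw [List.length_map, List.length_erase_of_mem (List.mem_range.2 (by omega)),
      List.length_range, Nat.add_sub_cancel]
  refine h.prod_ne_zero l hl (LinearMap.ker_eq_top.1 ?_)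
  rw [eq_top_iff, ← h.iSup_latticeV]
  refine iSup_le fun i => ?_
  rcases eq_or_ne (i : ℕ) j with hij | hij
  · rw [hij, hbot]
    exact bot_le
  · intro v hv
    rw [LinearMap.mem_ker]
    refine Module.End.prod_map_sub_smul_apply_eq_zero _ l (List.mem_map_of_mem ?_)
      (h.adjacencyOperator_eq_of_mem_latticeV (by omega) hv)
    exact (List.mem_erase_of_ne hij).2 (List.mem_range.2 i.2)

theorem latticeV_eq_eigenspace [Finite L] (h : LatticeCounts G e rk d θ c m N)
    (i : Fin (d + 1)) :
    latticeV e rk i = Module.End.eigenspace (adjacencyOperator G) (θ i) :=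
  iSupIndep.eq_of_le_of_iSup_eq_top
    ((Module.End.eigenspaces_iSupIndep (adjacencyOperator G)).comp h.injective_eigenvalues)
    (fun i _ hv => Module.End.mem_eigenspace_iff.2
      (h.adjacencyOperator_eq_of_mem_latticeV (by omega) hv))
    h.iSup_latticeV i

theorem iInf_eigenspace_distMatrix_le [Finite L] (h : LatticeCounts G e rk d θ c m N)
    {p : ℕ → ℝ} {j : ℕ} (hj : j ≤ d)
    (hp : ∀ i ≤ d, ∀ v ∈ latticeV e rk j, Matrix.mulVecLin (distMatrix G i) v = p i • v) :
    ⨅ i ∈ Finset.range (d + 1), Module.End.eigenspace (Matrix.mulVecLin (distMatrix G i)) (p i) ≤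
      latticeV e rk j := by
  -- For `d = 0` the matrix `A_1` is not in the list, but `V_0` is everything. Otherwise `A_1 = 𝒜`
  -- alone cuts out `V_j`, and a nonzero vector of `V_j` forces `p 1 = θ j`.
  rcases Nat.eq_zero_or_pos d with rfl | hd
  · obtain rfl : j = 0 := by omega
    have : latticeV e rk 0 = ⊤ := h.latticeLambda_diameter
    rw [this]
    exact le_top
  · refine (iInf₂_le 1 (Finset.mem_range.2 (by omega))).trans ?_
    obtain ⟨v, hv, hv0⟩ := (Submodule.ne_bot_iff _).1 (h.latticeV_ne_bot hj)
    have h1 := hp 1 hd v hv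
    rw [mulVecLin_distMatrix_one, h.adjacencyOperator_eq_of_mem_latticeV hj hv] at h1
    rw [mulVecLin_distMatrix_one, ← smul_left_injective ℝ hv0 h1]
    exact (h.latticeV_eq_eigenspace ⟨j, by omega⟩).ge

theorem describesEigenspaces [Finite L] (h : LatticeCounts G e rk d θ c m N) :
    LatticeDescribesEigenspaces G e rk d θ := by
  have hindep := Module.End.eigenspaces_iSupIndep (adjacencyOperator G)
  have heig : ∀ j ≤ d, latticeV e rk j = Module.End.eigenspace (adjacencyOperator G) (θ j) :=
    fun j hj => h.latticeV_eq_eigenspace ⟨j, by omega⟩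
  refine ⟨⟨?_, fun j hj => h.latticeV_ne_bot hj, ?_, heig, fun μ => ⟨fun hμ => ?_, ?_⟩,
    fun i j hij hj => h.strictAntiOn hij hj⟩, fun j hj v hv => h.adjacencyOperator_sub_mem hj hv⟩
  · rw [DirectSum.isInternal_submodule_iff_iSupIndep_and_iSup_eq_top]
    refine ⟨?_, h.iSup_latticeV⟩
    rw [funext h.latticeV_eq_eigenspace]
    exact hindep.comp h.injective_eigenvalues
  · have hex : ∀ i j : ℕ, ∃ s : ℝ, i ≤ d → j ≤ d → ∀ v ∈ latticeV e rk j,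
        Matrix.mulVecLin (distMatrix G i) v = s • v := by
      intro i j
      by_cases hij : i ≤ d ∧ j ≤ d
      · obtain ⟨s, hs⟩ := h.exists_scalar_distMatrix hij.2 hij.1
        exact ⟨s, fun _ _ => hs⟩
      · exact ⟨0, fun h1 h2 => absurd ⟨h1, h2⟩ hij⟩
    choose p hp using hex
    refine ⟨p, fun j hj => le_antisymm (le_iInf₂ fun i hi v hv => ?_) ?_⟩
    · exact Module.End.mem_eigenspace_iff.2
        (hp i j (Nat.lt_succ_iff.1 (Finset.mem_range.1 hi)) hj v hv)
    · exact h.iInf_eigenspace_distMatrix_le (p := fun i => p i j) hj fun i hi => hp i j hi hj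
  -- If `μ` is none of the `θ_j`, the eigenspaces for values other than `μ` already span, so
  -- independence makes the one for `μ` zero.
  · by_contra! hne
    refine hμ ((hindep μ).eq_bot_of_le ?_)
    have htop : (⊤ : Submodule ℝ (X → ℝ)) ≤
        ⨆ (ν : ℝ) (_ : ν ≠ μ), Module.End.eigenspace (adjacencyOperator G) ν := by
      rw [← h.iSup_latticeV]
      refine iSup_le fun i => ?_
      rw [h.latticeV_eq_eigenspace i]
      exact le_iSup₂_of_le (θ i) (hne i (by omega)).symm le_rfl
    exact le_top.trans htop
  · rintro ⟨j, hj, rfl⟩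
    rw [Module.End.hasEigenvalue_iff, ← heig j hj]
    exact h.latticeV_ne_bot hj

end LatticeCounts

/-! ### Recognising the graph distance -/

/-- An edge lowers `δ` by at most one, so no walk is shorter than `δ`; greedy descent builds a walk
of length `δ`. That walk also gives reachability, which excludes the default value `0` of `dist`. -/
theorem SimpleGraph.dist_eq_of_adj_step {X : Type*} {G : SimpleGraph X} {δ : X → X → ℕ}
    (hself : ∀ x, δ x x = 0) (hzero : ∀ x y, δ x y = 0 → x = y)
    (hadj : ∀ x z y, G.Adj x z → δ x y ≤ δ z y + 1)
    (hstep : ∀ x y, δ x y ≠ 0 → ∃ z, G.Adj x z ∧ δ z y + 1 = δ x y) (x y : X) :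
    G.dist x y = δ x y := by
  have hle : ∀ {x y : X} (p : G.Walk x y), δ x y ≤ p.length := by
    intro x y p
    induction p with
    | nil => simp [hself]
    | cons h p ih => exact (hadj _ _ _ h).trans (Nat.succ_le_succ ih)
  have hwalk : ∀ (l : ℕ) (x y : X), δ x y = l → ∃ p : G.Walk x y, p.length = l := by
    intro l
    induction l with
    | zero =>
      intro x y h
      obtain rfl := hzero x y h
      exact ⟨.nil, rfl⟩
    | succ l ih =>
      intro x y h
      obtain ⟨z, hz, hzy⟩ := hstep x y (by omega)
      obtain ⟨p, hp⟩ := ih z y (by omega)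
      exact ⟨.cons hz p, by simp [hp]⟩
  obtain ⟨p, hp⟩ := hwalk _ x y rfl
  refine le_antisymm (hp ▸ SimpleGraph.dist_le p) ?_
  obtain ⟨q, hq⟩ := (SimpleGraph.Walk.reachable p).exists_walk_length_eq_dist
  exact hq ▸ hle q

theorem latticeIota_eq_ite {X L : Type*} [Lattice L] {e : X → L} {z : L} {x : X} {p : Prop}
    [Decidable p] (h : z ≤ e x ↔ p) : latticeIota e z x = if p then 1 else 0 := by
  classical
  exact if_congr h rfl rfl

/-! ### Counting subsets -/

namespace Finset

variable {α : Type*} [DecidableEq α]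

theorem ncard_setOf_subset_inter (j : ℕ) (x y : Finset α) :
    {s : Finset α | s.card = j ∧ s ⊆ x ∧ s ⊆ y}.ncard = (x ∩ y).card.choose j := by
  rw [← card_powersetCard, ← Set.ncard_coe_finset]
  congr 1
  ext s
  simp [mem_powersetCard, subset_inter_iff, and_comm]

theorem ncard_setOf_covers {w x : Finset α} (h : w ⊆ x) :
    {s : Finset α | s.card = w.card + 1 ∧ w ⊆ s ∧ s ⊆ x}.ncard = x.card - w.card := by
  rw [← card_sdiff_of_subset h,
    ← card_image_of_injOn (f := fun a => insert a w) (s := x \ w) ?_,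
    ← Set.ncard_coe_finset (image _ _)]
  · congr 1
    ext s
    simp only [Set.mem_ofPred_eq, coe_image, Set.mem_image, coe_sdiff, Set.mem_sdiff, mem_coe]
    constructor
    · rintro ⟨h1, h2, h3⟩
      obtain ⟨a, ha, rfl⟩ := exists_eq_insert_iff.2 ⟨h2, h1.symm⟩
      exact ⟨a, ⟨h3 (mem_insert_self a w), ha⟩, rfl⟩
    · rintro ⟨a, ⟨ha, ha'⟩, rfl⟩
      exact ⟨card_insert_of_notMem ha', subset_insert a w, insert_subset ha h⟩
  · intro a ha b hb hab
    have ha := (mem_sdiff.1 (mem_coe.1 ha)).2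
    have h1 : a ∈ insert b w := by
      rw [← show insert a w = insert b w from hab]
      exact mem_insert_self a w
    exact (mem_insert.1 h1).resolve_right ha

/-- For nonempty `z` these are the subsets of `z ∩ x` of size `z.card - 1`, so only whether `z \ x`
has 0, 1 or more elements matters. For empty `z` there are none, in agreement with the first branch.
-/
theorem ncard_setOf_hyperplanes (z x : Finset α) :
    {s : Finset α | s.card + 1 = z.card ∧ s ⊆ z ∧ s ⊆ x}.ncard =
      if z ⊆ x then z.card else if (z \ x).card = 1 then 1 else 0 := by
  have hcard := card_sdiff_add_card_inter z x
  rcases Nat.eq_zero_or_pos z.card with h0 | hpos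
  · have : {s : Finset α | s.card + 1 = z.card ∧ s ⊆ z ∧ s ⊆ x} = ∅ := by
      refine Set.eq_empty_of_forall_notMem fun s hs => ?_
      have := hs.1
      omega
    rw [this, Set.ncard_empty, if_pos (by simp [card_eq_zero.1 h0]), h0]
  · have : {s : Finset α | s.card + 1 = z.card ∧ s ⊆ z ∧ s ⊆ x} =
        {s : Finset α | s.card = z.card - 1 ∧ s ⊆ z ∧ s ⊆ x} := by
      ext s
      exact and_congr_left fun _ => by omega
    rw [this, ncard_setOf_subset_inter]
    have hsub : z ⊆ x ↔ (z \ x).card = 0 := by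
      rw [card_eq_zero, sdiff_eq_empty_iff_subset]
    split_ifs with h1 h2
    · rw [hsub] at h1
      rw [show (z ∩ x).card = z.card by omega, ← Nat.choose_symm (Nat.sub_le _ _),
        Nat.sub_sub_self hpos, Nat.choose_one_right]
    · rw [show (z ∩ x).card = z.card - 1 by omega, Nat.choose_self]
    · rw [hsub] at h1
      exact Nat.choose_eq_zero_of_lt (by omega)

end Finset

/-! ### The Johnson graph -/

section Johnson

variable {n k : ℕ}

theorem johnsonRank_eq_iff {z : JohnsonLattice n k} {j : ℕ} (hj : j ≤ k) :
    johnsonRank n k z = j ↔ z.1.card = j := by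
  unfold johnsonRank
  split_ifs with h <;> omega

/-- The exceptional rank `k + 1` is out of reach of `j ≤ k`, so counts in the lattice become counts
of plain subsets. -/
theorem ncard_johnsonLattice {j : ℕ} (hj : j ≤ k) (P : Finset (Fin n) → Prop) :
    {z : JohnsonLattice n k | johnsonRank n k z = j ∧ P z.1}.ncard =
      {s : Finset (Fin n) | s.card = j ∧ P s}.ncard := by
  rw [← Set.ncard_image_of_injective _ Subtype.val_injective]
  congr 1
  ext s
  simp only [johnsonRank_eq_iff hj]
  constructor
  · rintro ⟨z, hz, rfl⟩
    exact hz
  · intro hs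
    exact ⟨⟨s, Or.inl (hs.1.le.trans hj)⟩, hs, rfl⟩

theorem card_insert_erase_eq {x : JohnsonVertex n k} {a b : Fin n} (ha : a ∈ x.1)
    (hb : b ∉ x.1) : (insert b (x.1.erase a)).card = k := by
  have h1 : b ∉ x.1.erase a := fun h => hb (Finset.mem_of_mem_erase h)
  have h2 := Finset.card_pos.2 ⟨a, ha⟩
  have h3 := x.2
  rw [Finset.card_insert_of_notMem h1, Finset.card_erase_of_mem ha]
  omega

theorem johnsonGraph_adj_iff {x y : JohnsonVertex n k} :
    (johnsonGraph n k).Adj x y ↔ ∃ a ∈ x.1, ∃ b ∉ x.1, y.1 = insert b (x.1.erase a) := by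
  change (x.1 ∩ y.1).card + 1 = k ↔ _
  constructor
  · intro h
    have h1 := Finset.card_sdiff_add_card_inter x.1 y.1
    have h2 := Finset.card_sdiff_add_card_inter y.1 x.1
    rw [Finset.inter_comm y.1, y.2] at h2
    rw [x.2] at h1
    obtain ⟨a, ha⟩ := Finset.card_eq_one.1 (show (x.1 \ y.1).card = 1 by omega)
    obtain ⟨b, hb⟩ := Finset.card_eq_one.1 (show (y.1 \ x.1).card = 1 by omega)
    have ha' : ∀ i, (i ∈ x.1 ∧ i ∉ y.1) ↔ i = a := fun i => by
      rw [← Finset.mem_sdiff, ha, Finset.mem_singleton]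
    have hb' : ∀ i, (i ∈ y.1 ∧ i ∉ x.1) ↔ i = b := fun i => by
      rw [← Finset.mem_sdiff, hb, Finset.mem_singleton]
    refine ⟨a, ((ha' a).2 rfl).1, b, ((hb' b).2 rfl).2, ?_⟩
    ext i
    rw [Finset.mem_insert, Finset.mem_erase, ne_eq, ← ha' i, ← hb' i]
    tauto
  · rintro ⟨a, ha, b, hb, h⟩
    have h1 : x.1 ∩ y.1 = x.1.erase a := by
      rw [h]
      ext i
      simp only [Finset.mem_inter, Finset.mem_insert, Finset.mem_erase]
      constructor
      · rintro ⟨h1, rfl | h2⟩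
        · exact absurd h1 hb
        · exact h2
      · exact fun h1 => ⟨h1.2, Or.inr h1⟩
    have h2 := Finset.card_pos.2 ⟨a, ha⟩
    have h3 := x.2
    rw [h1, Finset.card_erase_of_mem ha]
    omega

theorem johnsonGraph_dist (x y : JohnsonVertex n k) :
    (johnsonGraph n k).dist x y = k - (x.1 ∩ y.1).card := by
  have hle : ∀ x y : JohnsonVertex n k, (x.1 ∩ y.1).card ≤ k := fun x y =>
    (Finset.card_le_card Finset.inter_subset_left).trans x.2.le
  have hsdiff : ∀ x y : JohnsonVertex n k, (x.1 \ y.1).card + (x.1 ∩ y.1).card = k :=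
    fun x y => by rw [Finset.card_sdiff_add_card_inter, x.2]
  refine SimpleGraph.dist_eq_of_adj_step (δ := fun x y => k - (x.1 ∩ y.1).card) (fun x => ?_)
    (fun x y h => ?_) (fun x z y h => ?_) (fun x y h => ?_) x y
  · simp [x.2]
  · have h1 := hsdiff x y
    have h2 := hsdiff y x
    rw [Finset.inter_comm] at h2
    have h3 := hle x y
    refine Subtype.ext (Finset.Subset.antisymm ?_ ?_) <;>
    · rw [← Finset.sdiff_eq_empty_iff_subset, ← Finset.card_eq_zero]
      omega
  · have h1 : (x.1 ∩ z.1).card + 1 = k := h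
    have h2 := hsdiff z x
    rw [Finset.inter_comm] at h2
    -- Since `z \ x` is a single element, an edge changes the intersection with `y` by at most one.
    have h3 : (z.1 ∩ y.1).card ≤ (z.1 \ x.1).card + (x.1 ∩ y.1).card := by
      refine (Finset.card_le_card fun i hi => ?_).trans (Finset.card_union_le _ _)
      simp only [Finset.mem_union, Finset.mem_sdiff, Finset.mem_inter] at hi ⊢
      tauto
    have h4 := hle x y
    have h5 := hle z y
    change k - _ ≤ k - _ + 1
    omega
  · have h1 := hsdiff x y
    have h2 := hsdiff y x
    rw [Finset.inter_comm] at h2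
    obtain ⟨a, ha⟩ := Finset.card_pos.1 (show 0 < (x.1 \ y.1).card by omega)
    obtain ⟨b, hb⟩ := Finset.card_pos.1 (show 0 < (y.1 \ x.1).card by omega)
    rw [Finset.mem_sdiff] at ha hb
    refine ⟨⟨_, card_insert_erase_eq ha.1 hb.2⟩,
      johnsonGraph_adj_iff.2 ⟨a, ha.1, b, hb.2, rfl⟩, ?_⟩
    have h3 : insert b (x.1.erase a) ∩ y.1 = insert b (x.1 ∩ y.1) := by
      ext i
      simp only [Finset.mem_inter, Finset.mem_insert, Finset.mem_erase]
      constructor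
      · rintro ⟨rfl | h1, h2⟩
        · exact Or.inl rfl
        · exact Or.inr ⟨h1.2, h2⟩
      · rintro (rfl | h1)
        · exact ⟨Or.inl rfl, hb.1⟩
        · exact ⟨Or.inr ⟨fun h => ha.2 (h ▸ h1.2), h1.1⟩, h1.2⟩
    have h4 : b ∉ x.1 ∩ y.1 := fun h => hb.2 (Finset.mem_inter.1 h).1
    change k - (insert b (x.1.erase a) ∩ y.1).card + 1 = k - _
    rw [h3, Finset.card_insert_of_notMem h4]
    omega

/-- A neighbour removes a unique `a ∈ x` and adds a unique `b ∉ x`; it contains `z` exactly when `a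
∉ z` and `b` is the only possible element of `z \ x`. -/
theorem ncard_johnsonGraph_neighbors (x : JohnsonVertex n k) (z : Finset (Fin n)) :
    {y : JohnsonVertex n k | (johnsonGraph n k).Adj x y ∧ z ⊆ y.1}.ncard =
      (x.1 \ z).card * (x.1ᶜ.filter fun b => z \ x.1 ⊆ {b}).card := by
  rw [← Finset.card_product, ← Set.ncard_coe_finset]
  have hcard : ∀ p ∈ ((x.1 \ z) ×ˢ x.1ᶜ.filter fun b => z \ x.1 ⊆ {b} : Finset (Fin n × Fin n)),
      (insert p.2 (x.1.erase p.1)).card = k := by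
    intro p hp
    simp only [Finset.mem_product, Finset.mem_sdiff, Finset.mem_filter, Finset.mem_compl] at hp
    exact card_insert_erase_eq hp.1.1 hp.2.1
  refine (Set.ncard_congr (fun p hp => ⟨insert p.2 (x.1.erase p.1), hcard p hp⟩) ?_ ?_ ?_).symm
  · rintro ⟨a, b⟩ hp
    simp only [Finset.coe_product, Set.mem_prod, Finset.mem_coe, Finset.mem_sdiff,
      Finset.mem_filter, Finset.mem_compl] at hp
    refine ⟨johnsonGraph_adj_iff.2 ⟨a, hp.1.1, b, hp.2.1, rfl⟩, fun i hi => ?_⟩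
    rw [Finset.mem_insert, Finset.mem_erase]
    by_cases hix : i ∈ x.1
    · exact Or.inr ⟨fun h => hp.1.2 ((show i = a from h) ▸ hi), hix⟩
    · exact Or.inl (Finset.mem_singleton.1 (hp.2.2 (Finset.mem_sdiff.2 ⟨hi, hix⟩)))
  · rintro ⟨a, b⟩ ⟨a', b'⟩ hp hp' h
    simp only [Finset.coe_product, Set.mem_prod, Finset.mem_coe, Finset.mem_sdiff,
      Finset.mem_filter, Finset.mem_compl] at hp hp'
    have h : insert b (x.1.erase a) = insert b' (x.1.erase a') := congrArg Subtype.val h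
    have hb := Finset.ext_iff.1 h b
    have ha := Finset.ext_iff.1 h a
    simp only [Finset.mem_insert, Finset.mem_erase, true_or, true_iff, ne_eq, not_true,
      false_and, or_false] at ha hb
    have hb : b = b' := hb.resolve_right fun h => hp.2.1 h.2
    have hab : a ≠ b := fun h => hp.2.1 (h ▸ hp.1.1)
    have ha : a = a' := by
      by_contra hne
      exact hab (ha.2 (Or.inr ⟨hne, hp.1.1⟩))
    rw [ha, hb]
  · rintro y ⟨hy, hz⟩
    obtain ⟨a, ha, b, hb, h⟩ := johnsonGraph_adj_iff.1 hy
    rw [h] at hz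
    refine ⟨(a, b), ?_, Subtype.ext h.symm⟩
    simp only [Finset.coe_product, Set.mem_prod, Finset.mem_coe, Finset.mem_sdiff,
      Finset.mem_filter, Finset.mem_compl]
    refine ⟨⟨ha, fun haz => ?_⟩, hb, fun i hi => ?_⟩
    · rcases Finset.mem_insert.1 (hz haz) with rfl | h1
      · exact hb ha
      · simp at h1
    · rw [Finset.mem_sdiff] at hi
      rcases Finset.mem_insert.1 (hz hi.1) with rfl | h1
      · exact Finset.mem_singleton_self i
      · exact absurd (Finset.mem_of_mem_erase h1) hi.2

/-- With `j = |z|`, the case `|z \ x| = 1` leaves `|x \ z| = k - j + 1` neighbours and so dictates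
`c_j`. The case `z ⊆ x` has `(k - j)(n - k)` neighbours and `j` hyperplanes, which dictates `θ_j`.
If `|z \ x| ≥ 2`, both sides vanish. -/
theorem johnson_card_neighbors (x : JohnsonVertex n k) (z : Finset (Fin n)) :
    ({y : JohnsonVertex n k | (johnsonGraph n k).Adj x y ∧ z ⊆ y.1}.ncard : ℝ) =
      (((k : ℝ) - z.card) * ((n : ℝ) - k) - z.card * ((k : ℝ) - z.card + 1)) *
        (if z ⊆ x.1 then 1 else 0) +
      ((k : ℝ) - z.card + 1) *
        {s : Finset (Fin n) | s.card + 1 = z.card ∧ s ⊆ z ∧ s ⊆ x.1}.ncard := by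
  rw [ncard_johnsonGraph_neighbors, Finset.ncard_setOf_hyperplanes, Nat.cast_mul]
  have h1 := Finset.card_sdiff_add_card_inter z x.1
  have h2 := Finset.card_sdiff_add_card_inter x.1 z
  rw [Finset.inter_comm, x.2] at h2
  have hn : k ≤ n := by simpa [x.2] using Finset.card_le_univ x.1
  split_ifs with hzx hone
  · rw [Finset.sdiff_eq_empty_iff_subset.2 hzx, Finset.filter_true_of_mem (by simp),
      Finset.card_compl, x.2, Fintype.card_fin, Nat.cast_sub hn]
    rw [Finset.sdiff_eq_empty_iff_subset.2 hzx, Finset.card_empty] at h1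
    have h3 : ((x.1 \ z).card : ℝ) = k - z.card := by
      rw [eq_sub_iff_add_eq]
      exact_mod_cast (by omega : (x.1 \ z).card + z.card = k)
    rw [h3]
    ring
  · obtain ⟨b, hb⟩ := Finset.card_eq_one.1 hone
    have hbx : b ∉ x.1 := (Finset.mem_sdiff.1 (hb ▸ Finset.mem_singleton_self b)).2
    have h3 : (x.1ᶜ.filter fun b => z \ x.1 ⊆ {b}) = {b} := by
      ext i
      simp only [hb, Finset.mem_filter, Finset.mem_compl, Finset.singleton_subset_singleton,
        Finset.mem_singleton]
      exact ⟨fun h => h.2.symm, fun h => ⟨h ▸ hbx, h.symm⟩⟩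
    have h4 : ((x.1 \ z).card : ℝ) = k - z.card + 1 := by
      rw [sub_add_eq_add_sub, eq_sub_iff_add_eq]
      exact_mod_cast (by omega : (x.1 \ z).card + z.card = k + 1)
    rw [h3, h4, Finset.card_singleton]
    simp
  · have h3 : (x.1ᶜ.filter fun b => z \ x.1 ⊆ {b}) = ∅ := by
      refine Finset.filter_false_of_mem fun b _ h => ?_
      rcases Finset.subset_singleton_iff.1 h with h | h
      · exact hzx (Finset.sdiff_eq_empty_iff_subset.1 h)
      · exact hone (by rw [h, Finset.card_singleton])
    rw [h3]
    simp

theorem johnson_latticeCounts (hk : 2 * k ≤ n) :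
    LatticeCounts (johnsonGraph n k) (johnsonCoatom n k) (johnsonRank n k) k
      (fun j => ((k : ℝ) - j) * ((n : ℝ) - k) - j * ((k : ℝ) - j + 1))
      (fun j => (k : ℝ) - j + 1) (fun j => (k : ℝ) - j) (fun j r => (r.choose j : ℝ)) where
  eq_of_dist_eq_zero x y h := by
    rw [johnsonGraph_dist, Nat.sub_eq_zero_iff_le] at h
    have h1 := Finset.eq_of_subset_of_card_le Finset.inter_subset_left (x.2.le.trans h)
    have h2 := Finset.eq_of_subset_of_card_le Finset.inter_subset_right (y.2.le.trans h)
    exact Subtype.ext (h1.symm.trans h2)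
  dist_le x y := by
    rw [johnsonGraph_dist]
    exact Nat.sub_le _ _
  exists_dist_eq := by
    obtain ⟨x, -, hx⟩ := Finset.exists_subset_card_eq
      (show k ≤ (Finset.univ : Finset (Fin n)).card by rw [Finset.card_fin]; omega)
    obtain ⟨y, hy, hy'⟩ := Finset.exists_subset_card_eq
      (show k ≤ xᶜ.card by rw [Finset.card_compl, hx, Fintype.card_fin]; omega)
    refine ⟨⟨x, hx⟩, ⟨y, hy'⟩, ?_⟩
    rw [johnsonGraph_dist, Finset.disjoint_iff_inter_eq_empty.1
      (Finset.disjoint_of_subset_right hy disjoint_compl_right), Finset.card_empty, Nat.sub_zero]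
  card_neighbors z hz x := by
    have hcard : z.1.card = johnsonRank n k z := (johnsonRank_eq_iff hz).1 rfl
    simp only [SimpleGraph.dist_eq_one_iff_adj]
    have hw : {w : JohnsonLattice n k | johnsonRank n k w + 1 = johnsonRank n k z ∧ w ≤ z ∧
        w ≤ johnsonCoatom n k x}.ncard =
        {s : Finset (Fin n) | s.card + 1 = z.1.card ∧ s ⊆ z.1 ∧ s ⊆ x.1}.ncard := by
      rw [hcard]
      rcases hr : johnsonRank n k z with _ | j
      · simp
      · simp only [Nat.add_right_cancel_iff]
        exact ncard_johnsonLattice (by omega) (fun s => s ⊆ z.1 ∧ s ⊆ x.1)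
    rw [hw, ← hcard]
    have hiota : latticeIota (johnsonCoatom n k) z x = if z.1 ⊆ x.1 then 1 else 0 :=
      latticeIota_eq_ite Iff.rfl
    rw [hiota]
    exact johnson_card_neighbors x z.1
  card_covers w x hw hwx := by
    have hcard : w.1.card = johnsonRank n k w := (johnsonRank_eq_iff hw.le).1 rfl
    have h1 := ncard_johnsonLattice (k := k) (Nat.succ_le_of_lt hw)
      (fun s => w.1 ⊆ s ∧ s ⊆ x.1)
    have h2 := Finset.ncard_setOf_covers (show w.1 ⊆ x.1 from hwx)
    rw [hcard, x.2] at h2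
    rw [← Nat.cast_sub hw.le, ← h2]
    exact congrArg Nat.cast h1
  card_common j hj x y := by
    have h1 := ncard_johnsonLattice hj (fun s => s ⊆ x.1 ∧ s ⊆ y.1)
    rw [Finset.ncard_setOf_subset_inter] at h1
    have h2 : (x.1 ∩ y.1).card ≤ k := (Finset.card_le_card Finset.inter_subset_left).trans x.2.le
    rw [johnsonGraph_dist, Nat.sub_sub_self h2]
    exact congrArg Nat.cast h1
  common_of_lt j r h := by
    rw [Nat.choose_eq_zero_of_lt h, Nat.cast_zero]
  common_self j _ := by
    rw [Nat.choose_self, Nat.cast_one]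
  c_ne_zero j hj := by
    have : (j : ℝ) < k := by exact_mod_cast hj
    push_cast
    linarith
  m_ne_zero j hj := by
    have : (j : ℝ) < k := by exact_mod_cast hj
    exact (sub_pos.2 this).ne'
  succ_lt j hj := by
    have h1 : (j : ℝ) + 1 ≤ k := by exact_mod_cast hj
    have h2 : 2 * (k : ℝ) ≤ n := by exact_mod_cast hk
    push_cast
    -- The difference of the two eigenvalues is `n - 2j`, positive because `2j < 2k ≤ n`.
    nlinarith

theorem johnson_describesEigenspaces (hk : 2 * k ≤ n) : ∃ θ : ℕ → ℝ,
    LatticeDescribesEigenspaces (johnsonGraph n k) (johnsonCoatom n k) (johnsonRank n k) k θ ∧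
    θ k = -(k : ℝ) ∧ ∀ j < k, θ j = θ (j + 1) + ((n : ℝ) - 2 * (j : ℝ)) := by
  refine ⟨_, (johnson_latticeCounts hk).describesEigenspaces, ?_, fun j _ => ?_⟩
  · ring
  · push_cast
    ring

end Johnson

/-! ### The hypercube -/

section Cube

variable {n : ℕ}

/-- The partial word with support `S` that agrees with the word `u` on `S`. -/
def cubeRestrict (u : CubeVertex n) (S : Finset (Fin n)) : CubeLattice n :=
  WithTop.some ⟨(S.filter fun i => u i = 1, S.filter fun i => u i = -1), by
    rw [Finset.disjoint_filter]
    intro i _ h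
    rw [h]
    decide⟩

theorem cubeRestrict_le_cubeRestrict {u v : CubeVertex n} {S T : Finset (Fin n)} :
    cubeRestrict u S ≤ cubeRestrict v T ↔ ∀ i ∈ S, i ∈ T ∧ u i = v i := by
  have h : cubeRestrict u S ≤ cubeRestrict v T ↔
      (S.filter fun i => u i = 1) ⊆ (T.filter fun i => v i = 1) ∧
      (S.filter fun i => u i = -1) ⊆ (T.filter fun i => v i = -1) := WithTop.coe_le_coe
  rw [h]
  simp only [Finset.subset_iff, Finset.mem_filter]
  constructor
  · rintro ⟨h1, h2⟩ i hi
    rcases Int.units_eq_one_or (u i) with hu | hu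
    · exact ⟨(h1 ⟨hi, hu⟩).1, hu.trans (h1 ⟨hi, hu⟩).2.symm⟩
    · exact ⟨(h2 ⟨hi, hu⟩).1, hu.trans (h2 ⟨hi, hu⟩).2.symm⟩
  · exact fun h => ⟨fun i hi => ⟨(h i hi.1).1, (h i hi.1).2 ▸ hi.2⟩,
      fun i hi => ⟨(h i hi.1).1, (h i hi.1).2 ▸ hi.2⟩⟩

theorem cubeRestrict_univ (x : CubeVertex n) : cubeRestrict x Finset.univ = cubeCoatom n x := rfl

theorem cubeRestrict_le_cubeCoatom {u x : CubeVertex n} {S : Finset (Fin n)} :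
    cubeRestrict u S ≤ cubeCoatom n x ↔ S ⊆ Finset.univ.filter fun i => u i = x i := by
  rw [← cubeRestrict_univ, cubeRestrict_le_cubeRestrict]
  simp [Finset.subset_iff]

theorem cubeRestrict_le_same {u : CubeVertex n} {S T : Finset (Fin n)} :
    cubeRestrict u S ≤ cubeRestrict u T ↔ S ⊆ T := by
  rw [cubeRestrict_le_cubeRestrict]
  simp [Finset.subset_iff]

theorem cubeRestrict_injective (u : CubeVertex n) : Function.Injective (cubeRestrict u) :=
  fun _ _ h => Finset.Subset.antisymm (cubeRestrict_le_same.1 h.le) (cubeRestrict_le_same.1 h.ge)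

theorem cubeRank_cubeRestrict (u : CubeVertex n) (S : Finset (Fin n)) :
    cubeRank n (cubeRestrict u S) = S.card := by
  change (S.filter fun i => u i = 1).card + (S.filter fun i => u i = -1).card = _
  rw [← Finset.card_union_of_disjoint]
  · congr 1
    ext i
    rw [Finset.mem_union, Finset.mem_filter, Finset.mem_filter, ← and_or_left]
    exact and_iff_left (Int.units_eq_one_or (u i))
  · rw [Finset.disjoint_filter]
    intro i _ h
    rw [h]
    decide

theorem exists_eq_cubeRestrict {z : CubeLattice n} (hz : cubeRank n z ≤ n) :
    ∃ u S, z = cubeRestrict u S := by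
  induction z using WithTop.recTopCoe with
  | top => exact absurd hz (Nat.not_succ_le_self n)
  | coe z =>
    obtain ⟨⟨I, J⟩, hIJ⟩ := z
    -- The letters outside `I ∪ J` are irrelevant; `-1` is an arbitrary choice there.
    refine ⟨fun i => if i ∈ I then 1 else -1, I ∪ J, ?_⟩
    refine congrArg WithTop.some (Subtype.ext (Prod.ext ?_ ?_))
    · ext i
      by_cases hi : i ∈ I <;> simp [hi]
    · ext i
      by_cases hi : i ∈ I
      · simp [hi, Finset.disjoint_left.1 hIJ hi]
      · simp [hi]

/-- The interval below a partial word is the Boolean lattice of its support, so the subset counts of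
the Johnson case apply again. -/
theorem le_cubeRestrict_iff {z : CubeLattice n} {u : CubeVertex n} {T : Finset (Fin n)} :
    z ≤ cubeRestrict u T ↔ ∃ S ⊆ T, z = cubeRestrict u S := by
  constructor
  · intro h
    have hz : cubeRank n z ≤ n := by
      induction z using WithTop.recTopCoe with
      | top => exact absurd h (WithTop.not_top_le_coe _)
      | coe z =>
        change z.1.1.card + z.1.2.card ≤ n
        rw [← Finset.card_union_of_disjoint z.2]
        simpa using Finset.card_le_univ (z.1.1 ∪ z.1.2)
    obtain ⟨v, S, rfl⟩ := exists_eq_cubeRestrict hz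
    have h' := cubeRestrict_le_cubeRestrict.1 h
    refine ⟨S, fun i hi => (h' i hi).1, le_antisymm ?_ ?_⟩
    · exact cubeRestrict_le_cubeRestrict.2 fun i hi => ⟨hi, (h' i hi).2⟩
    · exact cubeRestrict_le_cubeRestrict.2 fun i hi => ⟨hi, (h' i hi).2.symm⟩
  · rintro ⟨S, hS, rfl⟩
    exact cubeRestrict_le_same.2 hS

/-- Counting below a partial word amounts to counting subsets of its support. -/
theorem ncard_le_cubeRestrict (u : CubeVertex n) (T : Finset (Fin n)) (P : ℕ → Prop)
    (Q : CubeLattice n → Prop) :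
    {z | P (cubeRank n z) ∧ z ≤ cubeRestrict u T ∧ Q z}.ncard =
      {S : Finset (Fin n) | P S.card ∧ S ⊆ T ∧ Q (cubeRestrict u S)}.ncard := by
  rw [← Set.ncard_image_of_injective _ (cubeRestrict_injective u)]
  congr 1
  ext z
  constructor
  · rintro ⟨h1, h2, h3⟩
    obtain ⟨S, hS, rfl⟩ := le_cubeRestrict_iff.1 h2
    rw [cubeRank_cubeRestrict] at h1
    exact ⟨S, ⟨h1, hS, h3⟩, rfl⟩
  · rintro ⟨S, ⟨h1, h2, h3⟩, rfl⟩
    exact ⟨(cubeRank_cubeRestrict u S).symm ▸ h1, cubeRestrict_le_same.2 h2, h3⟩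

theorem hammingDist_add_card_eq (x y : CubeVertex n) :
    hammingDist x y + (Finset.univ.filter fun i => x i = y i).card = n := by
  rw [hammingDist, add_comm, Finset.card_filter_add_card_filter_not, Finset.card_fin]

theorem cubeGraph_adj_iff {x y : CubeVertex n} :
    (cubeGraph n).Adj x y ↔ ∃ i, y = Function.update x i (-x i) := by
  change hammingDist x y = 1 ↔ _
  rw [hammingDist, Finset.card_eq_one]
  refine exists_congr fun i => ?_
  simp only [Finset.ext_iff, Finset.mem_filter, Finset.mem_univ, true_and,
    Finset.mem_singleton, funext_iff]
  refine forall_congr' fun l => ?_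
  rcases eq_or_ne l i with rfl | hl
  · rw [Function.update_self, eq_comm (a := y l), neg_eq_iff_eq_neg]
    have := Int.units_ne_iff_eq_neg (u := x l) (v := y l)
    tauto
  · rw [Function.update_of_ne hl]
    simp [hl, eq_comm]

theorem cubeGraph_dist (x y : CubeVertex n) : (cubeGraph n).dist x y = hammingDist x y := by
  refine SimpleGraph.dist_eq_of_adj_step (δ := fun x y => hammingDist x y) hammingDist_self
    (fun _ _ => hammingDist_eq_zero.1) (fun x z y h => ?_) (fun x y h => ?_) x y
  · have h1 : hammingDist x z = 1 := h
    have h2 := hammingDist_triangle x z y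
    change hammingDist x y ≤ hammingDist z y + 1
    omega
  · obtain ⟨i, hi⟩ : ∃ i, x i ≠ y i := by
      by_contra! hxy
      exact h (hammingDist_eq_zero.2 (funext hxy))
    have hne : -x i = y i := by
      rw [Int.units_ne_iff_eq_neg.1 hi, neg_neg]
    refine ⟨_, cubeGraph_adj_iff.2 ⟨i, rfl⟩, ?_⟩
    have h1 : (Finset.univ.filter fun l => Function.update x i (-x i) l ≠ y l) =
        (Finset.univ.filter fun l => x l ≠ y l).erase i := by
      ext l
      rcases eq_or_ne l i with rfl | hl
      · simp [hne]
      · simp [hl]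
    change hammingDist (Function.update x i (-x i)) y + 1 = hammingDist x y
    rw [hammingDist, h1, hammingDist]
    exact Finset.card_erase_add_one (Finset.mem_filter.2 ⟨Finset.mem_univ i, hi⟩)

/-- Flipping `x` at `i` toggles agreement with `u` at `i` alone, so the flipped word agrees with `u`
on `S` exactly when the old disagreements inside `S` are `S ∩ {i}`. -/
theorem ncard_cubeGraph_neighbors (x u : CubeVertex n) (S : Finset (Fin n)) :
    {y | (cubeGraph n).Adj x y ∧ cubeRestrict u S ≤ cubeCoatom n y}.ncard =
      (Finset.univ.filter fun i => S \ (Finset.univ.filter fun l => u l = x l) = S ∩ {i}).card := by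
  have hinj : Function.Injective fun i => Function.update x i (-x i) := by
    intro i j hij
    by_contra hne
    have := congrFun hij i
    simp only [Function.update_self, Function.update_of_ne hne] at this
    exact (Int.units_ne_iff_eq_neg.2 (neg_eq_iff_eq_neg.1 this)) rfl
  rw [← Set.ncard_coe_finset, ← Set.ncard_image_of_injective _ hinj]
  congr 1
  have hiff : ∀ i, cubeRestrict u S ≤ cubeCoatom n (Function.update x i (-x i)) ↔
      S \ (Finset.univ.filter fun l => u l = x l) = S ∩ {i} := by
    intro i
    rw [cubeRestrict_le_cubeCoatom]
    simp only [Finset.subset_iff, Finset.ext_iff, Finset.mem_filter, Finset.mem_univ, true_and,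
      Finset.mem_sdiff, Finset.mem_inter, Finset.mem_singleton, and_congr_right_iff]
    refine forall₂_congr fun l _ => ?_
    rcases eq_or_ne l i with rfl | hl
    · rw [Function.update_self, ← Int.units_ne_iff_eq_neg]
      tauto
    · rw [Function.update_of_ne hl]
      simp [hl]
  ext y
  constructor
  · rintro ⟨hy, hS⟩
    obtain ⟨i, rfl⟩ := cubeGraph_adj_iff.1 hy
    exact ⟨i, by simpa using (hiff i).1 hS, rfl⟩
  · rintro ⟨i, hi, rfl⟩
    exact ⟨cubeGraph_adj_iff.2 ⟨i, rfl⟩, (hiff i).2 (by simpa using hi)⟩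

/-- With no disagreement on `S`, the flips outside `S` count `n - |S| = (n - 2|S|) + |S|`. With one
disagreement, only the flip there works; with more, none does. Hence `c = 1`. -/
theorem cube_card_neighbors (x u : CubeVertex n) (S : Finset (Fin n)) :
    ({y | (cubeGraph n).Adj x y ∧ cubeRestrict u S ≤ cubeCoatom n y}.ncard : ℝ) =
      ((n : ℝ) - 2 * S.card) *
        (if S ⊆ Finset.univ.filter (fun i => u i = x i) then 1 else 0) +
      {T : Finset (Fin n) | T.card + 1 = S.card ∧ T ⊆ S ∧
        T ⊆ Finset.univ.filter fun i => u i = x i}.ncard := by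
  rw [ncard_cubeGraph_neighbors, Finset.ncard_setOf_hyperplanes]
  set E := Finset.univ.filter fun i => u i = x i
  split_ifs with hS hone
  · have h1 : (Finset.univ.filter fun i => S \ E = S ∩ {i}) = Sᶜ := by
      ext i
      rw [Finset.sdiff_eq_empty_iff_subset.2 hS, Finset.mem_filter, Finset.mem_compl, eq_comm,
        ← Finset.disjoint_iff_inter_eq_empty, Finset.disjoint_singleton_right]
      exact and_iff_right (Finset.mem_univ i)
    rw [h1, Finset.card_compl, Fintype.card_fin, Nat.cast_sub (by simpa using S.card_le_univ)]
    ring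
  · obtain ⟨a, ha⟩ := Finset.card_eq_one.1 hone
    have haS : a ∈ S := (Finset.mem_sdiff.1 (ha ▸ Finset.mem_singleton_self a)).1
    have h1 : (Finset.univ.filter fun i => S \ E = S ∩ {i}) = {a} := by
      ext i
      rw [ha, Finset.mem_filter, Finset.mem_singleton]
      constructor
      · rintro ⟨-, h⟩
        have := Finset.inter_subset_right (h ▸ Finset.mem_singleton_self a)
        exact (Finset.mem_singleton.1 this).symm
      · rintro rfl
        exact ⟨Finset.mem_univ i, (Finset.inter_singleton_of_mem haS).symm⟩
    rw [h1]
    simp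
  · have h1 : (Finset.univ.filter fun i => S \ E = S ∩ {i}) = ∅ := by
      refine Finset.filter_false_of_mem fun i _ h => ?_
      rcases Finset.subset_singleton_iff.1 (h.le.trans Finset.inter_subset_right) with h | h
      · exact hS (Finset.sdiff_eq_empty_iff_subset.1 h)
      · exact hone (by rw [h, Finset.card_singleton])
    rw [h1]
    simp

theorem cube_latticeCounts (n : ℕ) :
    LatticeCounts (cubeGraph n) (cubeCoatom n) (cubeRank n) n (fun j => (n : ℝ) - 2 * j)
      (fun _ => 1) (fun j => (n : ℝ) - j) (fun j r => (r.choose j : ℝ)) where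
  eq_of_dist_eq_zero x y h := by
    rw [cubeGraph_dist] at h
    exact hammingDist_eq_zero.1 h
  dist_le x y := by
    rw [cubeGraph_dist]
    exact (Nat.le_add_right _ _).trans (hammingDist_add_card_eq x y).le
  exists_dist_eq := by
    refine ⟨fun _ => 1, fun _ => -1, ?_⟩
    have h := hammingDist_add_card_eq (n := n) (fun _ => 1) fun _ => -1
    rw [Finset.filter_false_of_mem fun _ _ => by decide, Finset.card_empty, add_zero] at h
    rw [cubeGraph_dist, h]
  card_neighbors z hz x := by
    obtain ⟨u, S, rfl⟩ := exists_eq_cubeRestrict hz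
    simp only [SimpleGraph.dist_eq_one_iff_adj]
    rw [latticeIota_eq_ite cubeRestrict_le_cubeCoatom, cubeRank_cubeRestrict, one_mul,
      ncard_le_cubeRestrict u S (fun r => r + 1 = S.card) (fun w => w ≤ cubeCoatom n x)]
    simp only [cubeRestrict_le_cubeCoatom (x := x)]
    rw [← cube_card_neighbors]
  card_covers w x hw hwx := by
    rw [← cubeRestrict_univ, le_cubeRestrict_iff] at hwx
    obtain ⟨T, -, rfl⟩ := hwx
    rw [cubeRank_cubeRestrict] at hw ⊢
    have h1 := ncard_le_cubeRestrict x Finset.univ (fun r => r = T.card + 1)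
      (fun z => cubeRestrict x T ≤ z)
    simp only [cubeRestrict_le_same, cubeRestrict_univ] at h1
    have h2 := Finset.ncard_setOf_covers (Finset.subset_univ T)
    rw [Finset.card_fin] at h2
    rw [← Nat.cast_sub hw.le, ← h2]
    simp only [and_comm (a := cubeRestrict x T ≤ _), and_comm (a := T ⊆ _)]
    exact congrArg Nat.cast h1
  card_common j hj x y := by
    have h1 := ncard_le_cubeRestrict x Finset.univ (fun r => r = j) (fun z => z ≤ cubeCoatom n y)
    simp only [cubeRestrict_le_cubeCoatom, cubeRestrict_univ] at h1
    rw [Finset.ncard_setOf_subset_inter, Finset.univ_inter] at h1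
    have h2 := hammingDist_add_card_eq x y
    rw [cubeGraph_dist, h1]
    congr 2
    omega
  common_of_lt j r h := by
    rw [Nat.choose_eq_zero_of_lt h, Nat.cast_zero]
  common_self j _ := by
    rw [Nat.choose_self, Nat.cast_one]
  c_ne_zero _ _ := one_ne_zero
  m_ne_zero j hj := by
    have : (j : ℝ) < n := by exact_mod_cast hj
    exact (sub_pos.2 this).ne'
  succ_lt j hj := by
    push_cast
    linarith

theorem cube_describesEigenspaces (n : ℕ) : ∃ θ : ℕ → ℝ,
    LatticeDescribesEigenspaces (cubeGraph n) (cubeCoatom n) (cubeRank n) n θ ∧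
    θ n = -(n : ℝ) ∧ ∀ j < n, θ j = θ (j + 1) + 2 := by
  refine ⟨_, (cube_latticeCounts n).describesEigenspaces, ?_, fun j _ => ?_⟩
  · ring
  · push_cast
    ring

end Cube

/-! ### Fibre counting and `q`-brackets -/

theorem Set.ncard_eq_mul_of_fibers {α β : Type*} [Finite α] [Finite β] {s : Set α} {t : Set β}
    {f : α → β} (hf : ∀ a ∈ s, f a ∈ t) {m : ℝ}
    (hm : ∀ b ∈ t, ({a | a ∈ s ∧ f a = b}.ncard : ℝ) = m) : (s.ncard : ℝ) = t.ncard * m := by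
  classical
  have := Fintype.ofFinite α
  have := Fintype.ofFinite β
  rw [Set.ncard_eq_toFinset_card' s, Set.ncard_eq_toFinset_card' t,
    Finset.card_eq_sum_card_fiberwise (f := f) (t := t.toFinset)
      (fun a ha => by simpa using hf a (by simpa using ha)),
    Nat.cast_sum, ← nsmul_eq_mul, ← Finset.sum_const]
  refine Finset.sum_congr rfl fun b hb => ?_
  rw [← hm b (Set.mem_toFinset.1 hb), ← Set.ncard_coe_finset]
  simp

theorem qBracket_succ_sub_one {q : ℕ} (hq : 1 < q) (i : ℕ) :
    qBracket q (i + 1) - 1 = q * qBracket q i := by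
  have h : (q : ℝ) - 1 ≠ 0 := sub_ne_zero.2 (by exact_mod_cast hq.ne')
  unfold qBracket
  field_simp
  ring

theorem qBracket_pos {q : ℕ} (hq : 1 < q) {i : ℕ} (hi : i ≠ 0) : 0 < qBracket q i := by
  have h : (1 : ℝ) < q := by exact_mod_cast hq
  exact div_pos (sub_pos.2 (one_lt_pow₀ h hi)) (sub_pos.2 h)

/-! ### Counting subspaces over a finite field -/

section Subspaces

open Module

variable {F V : Type*} [Field F] [AddCommGroup V] [Module F V] [Module.Finite F V]

theorem Submodule.finrank_sup_span_singleton_of_notMem {W : Submodule F V} {v : V}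
    (hv : v ∉ W) : finrank F (W ⊔ span F {v} : Submodule F V) = finrank F W + 1 := by
  have h0 : v ≠ 0 := fun h => hv (h ▸ W.zero_mem)
  have h1 := finrank_sup_add_finrank_inf_eq W (span F {v})
  have h2 : W ⊓ span F {v} = ⊥ :=
    disjoint_iff.1 ((disjoint_span_singleton' h0).2 hv)
  rw [h2, finrank_bot, finrank_span_singleton h0] at h1
  exact h1

theorem Submodule.exists_between_finrank_eq {W S : Submodule F V} (h : W ≤ S) {m : ℕ}
    (hW : finrank F W ≤ m) (hS : m ≤ finrank F S) :
    ∃ U : Submodule F V, W ≤ U ∧ U ≤ S ∧ finrank F U = m := by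
  induction m, hW using Nat.le_induction with
  | base => exact ⟨W, le_rfl, h, rfl⟩
  | succ m _ ih =>
    obtain ⟨U, h1, h2, h3⟩ := ih (by omega)
    have h4 : U < S := lt_of_le_of_ne h2 fun h => by
      rw [h] at h3
      omega
    obtain ⟨v, hv, hv'⟩ := SetLike.exists_of_lt h4
    exact ⟨U ⊔ span F {v}, h1.trans le_sup_left,
      sup_le h2 ((span_singleton_le_iff_mem v S).2 hv),
      by rw [finrank_sup_span_singleton_of_notMem hv', h3]⟩

theorem Submodule.finite_of_finite_field [Finite F] : Finite (Submodule F V) :=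
  have : Finite V := Module.finite_of_finite F
  Finite.of_injective _ SetLike.coe_injective

theorem Submodule.ncard_diff_of_le [Finite F] {W U : Submodule F V} (h : W ≤ U) :
    (((U : Set V) \ W).ncard : ℝ) = (Nat.card F : ℝ) ^ finrank F U -
      (Nat.card F : ℝ) ^ finrank F W := by
  have : Finite V := Module.finite_of_finite F
  have hc : ∀ S : Submodule F V, (S : Set V).ncard = Nat.card F ^ finrank F S :=
    fun S => (Nat.card_coe_set_eq _).symm.trans Module.natCard_eq_pow_finrank
  have h1 := Set.ncard_sdiff_add_ncard_of_subset (show (W : Set V) ⊆ U from h)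
  rw [hc, hc] at h1
  rw [eq_sub_iff_add_eq]
  exact_mod_cast h1

/-- The map `v ↦ W + ⟨v⟩` sends `Y \ W` onto the covers `U`, with fibre `U \ W` of size `q^(w+1) -
q^w`, where `w = dim W`. -/
theorem Submodule.ncard_covers [Finite F] {W Y : Submodule F V} (h : W ≤ Y) :
    ({U : Submodule F V | finrank F U = finrank F W + 1 ∧ W ≤ U ∧ U ≤ Y}.ncard : ℝ) =
      qBracket (Nat.card F) (finrank F Y - finrank F W) := by
  have : Finite V := Module.finite_of_finite F
  have : Finite (Submodule F V) := finite_of_finite_field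
  have hq : (1 : ℝ) < Nat.card F := by exact_mod_cast (Finite.one_lt_card : 1 < Nat.card F)
  have h1 := Set.ncard_eq_mul_of_fibers (s := (Y : Set V) \ W)
    (t := {U : Submodule F V | finrank F U = finrank F W + 1 ∧ W ≤ U ∧ U ≤ Y})
    (f := fun v => W ⊔ span F {v})
    (m := (Nat.card F : ℝ) ^ (finrank F W + 1) - (Nat.card F : ℝ) ^ finrank F W)
    (fun v hv => ⟨finrank_sup_span_singleton_of_notMem hv.2, le_sup_left,
      sup_le h ((span_singleton_le_iff_mem v Y).2 hv.1)⟩) ?_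
  · rw [ncard_diff_of_le h] at h1
    have hpos : (0 : ℝ) < (Nat.card F : ℝ) ^ finrank F W := pow_pos (by linarith) _
    have h2 : (Nat.card F : ℝ) ^ finrank F Y = (Nat.card F : ℝ) ^ finrank F W *
        (Nat.card F : ℝ) ^ (finrank F Y - finrank F W) := by
      rw [← pow_add, Nat.add_sub_cancel' (finrank_mono h)]
    rw [h2, pow_succ] at h1
    rw [qBracket, eq_div_iff (sub_pos.2 hq).ne']
    refine mul_left_cancel₀ hpos.ne' ?_
    linarith
  · rintro U ⟨h2, h3, h4⟩
    rw [← h2, ← ncard_diff_of_le h3]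
    congr 2
    ext v
    constructor
    · rintro ⟨hv, rfl⟩
      exact ⟨(le_sup_right : span F {v} ≤ _) (mem_span_singleton_self v), hv.2⟩
    · rintro ⟨hv, hv'⟩
      refine ⟨⟨h4 hv, hv'⟩, eq_of_le_of_finrank_eq
        (sup_le h3 ((span_singleton_le_iff_mem v U).2 hv)) ?_⟩
      rw [finrank_sup_span_singleton_of_notMem hv', h2]

/-- Annihilators turn hyperplanes of `Y` above `W` into covers of the annihilator of `Y` inside that
of `W`. -/
theorem Submodule.ncard_hyperplanes [Finite F] {W Y : Submodule F V} (h : W ≤ Y) :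
    ({U : Submodule F V | finrank F U + 1 = finrank F Y ∧ W ≤ U ∧ U ≤ Y}.ncard : ℝ) =
      qBracket (Nat.card F) (finrank F Y - finrank F W) := by
  have hd : ∀ U : Submodule F V, finrank F U + finrank F U.dualAnnihilator = finrank F V :=
    Subspace.finrank_add_finrank_dualAnnihilator_eq
  have h1 := ncard_covers (Subspace.dualAnnihilator_le_dualAnnihilator_iff.2 h)
  have hWd := hd W
  have hYd := hd Y
  have hWY := finrank_mono h
  rw [show finrank F W.dualAnnihilator - finrank F Y.dualAnnihilator =
    finrank F Y - finrank F W by omega] at h1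
  rw [← h1, ← Set.ncard_image_of_injective (f := dualAnnihilator) _
    fun _ _ => Subspace.dualAnnihilator_inj.1]
  congr 2
  ext U
  constructor
  · rintro ⟨U, ⟨h2, h3, h4⟩, rfl⟩
    have := hd U
    exact ⟨by omega, Subspace.dualAnnihilator_le_dualAnnihilator_iff.2 h4,
      Subspace.dualAnnihilator_le_dualAnnihilator_iff.2 h3⟩
  · rintro ⟨h2, h3, h4⟩
    have hU : U.dualCoannihilator.dualAnnihilator = U :=
      Subspace.dualCoannihilator_dualAnnihilator_eq
    have := hd U.dualCoannihilator
    rw [hU] at this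
    refine ⟨U.dualCoannihilator, ⟨by omega, ?_, ?_⟩, hU⟩
    · rwa [← Subspace.dualAnnihilator_le_dualAnnihilator_iff, hU]
    · rwa [← Subspace.dualAnnihilator_le_dualAnnihilator_iff, hU]

/-- The number of `j`-dimensional subspaces of `F ^ r`. -/
noncomputable def subspaceCount (F : Type*) [Field F] (j r : ℕ) : ℕ :=
  {U : Submodule F (Fin r → F) | finrank F U = j}.ncard

theorem subspaceCount_of_lt {j r : ℕ} (h : r < j) : subspaceCount F j r = 0 := by
  have : {U : Submodule F (Fin r → F) | finrank F U = j} = ∅ := by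
    refine Set.eq_empty_of_forall_notMem fun U hU => ?_
    have h1 := Submodule.finrank_le U
    rw [finrank_fin_fun, show finrank F U = j from hU] at h1
    omega
  rw [subspaceCount, this, Set.ncard_empty]

theorem subspaceCount_self (j : ℕ) : subspaceCount F j j = 1 := by
  rw [subspaceCount, Set.ncard_eq_one]
  refine ⟨⊤, Set.ext fun U => ⟨fun hU => ?_, ?_⟩⟩
  · exact Submodule.eq_top_of_finrank_eq (hU.trans (finrank_fin_fun F).symm)
  · rintro rfl
    exact (finrank_top F _).trans (finrank_fin_fun F)

/-- A basis of `S` shows that the count depends only on `dim S`. No Gaussian binomial formula is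
needed: the argument uses only that the count is `0` for `r < j` and `1` for `r = j`. -/
theorem ncard_finrank_eq_le (S : Submodule F V) (j : ℕ) :
    {U : Submodule F V | finrank F U = j ∧ U ≤ S}.ncard = subspaceCount F j (finrank F S) := by
  let e : (Fin (finrank F S) → F) ≃ₗ[F] S := (finBasis F S).equivFun.symm
  let f : (Fin (finrank F S) → F) →ₗ[F] V := S.subtype ∘ₗ e.toLinearMap
  have hf : Function.Injective f := S.injective_subtype.comp e.injective
  have hrange : LinearMap.range f = S := by
    rw [LinearMap.range_comp, LinearEquiv.range, Submodule.map_top, Submodule.range_subtype]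
  have hfin : ∀ U : Submodule F (Fin (finrank F S) → F), finrank F (U.map f) =
      finrank F U := fun U =>
    (Submodule.equivMapOfInjective f hf U).finrank_eq.symm
  rw [subspaceCount, ← Set.ncard_image_of_injective _ (Submodule.map_injective_of_injective hf)]
  congr 1
  ext U
  constructor
  · rintro ⟨h1, h2⟩
    have h3 : (U.comap f).map f = U := by
      rw [Submodule.map_comap_eq, hrange, inf_eq_right.2 h2]
    refine ⟨U.comap f, ?_, h3⟩
    rw [Set.mem_ofPred_eq, ← hfin, h3, h1]
  · rintro ⟨U, rfl, rfl⟩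
    exact ⟨hfin U, LinearMap.map_le_range.trans hrange.le⟩

open Classical in
/-- The hyperplanes of `z` that are contained in `x`. -/
theorem ncard_hyperplanes_le [Finite F] (z x : Submodule F V) :
    ({s : Submodule F V | finrank F s + 1 = finrank F z ∧ s ≤ z ∧ s ≤ x}.ncard : ℝ) =
      if z ≤ x then qBracket (Nat.card F) (finrank F z) else
        if finrank F (z ⊓ x : Submodule F V) + 1 = finrank F z then 1 else 0 := by
  split_ifs with h1 h2
  · have := Submodule.ncard_hyperplanes (bot_le : ⊥ ≤ z)
    rw [finrank_bot, Nat.sub_zero] at this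
    rw [← this]
    congr 2
    ext s
    exact and_congr_right fun _ => ⟨fun h => ⟨bot_le, h.1⟩, fun h => ⟨h.2, h.2.trans h1⟩⟩
  · have : {s : Submodule F V | finrank F s + 1 = finrank F z ∧ s ≤ z ∧ s ≤ x} = {z ⊓ x} := by
      ext s
      constructor
      · rintro ⟨h3, h4, h5⟩
        exact Submodule.eq_of_le_of_finrank_eq (le_inf h4 h5) (by omega)
      · rintro rfl
        exact ⟨h2, inf_le_left, inf_le_right⟩
    rw [this, Set.ncard_singleton, Nat.cast_one]
  · have : {s : Submodule F V | finrank F s + 1 = finrank F z ∧ s ≤ z ∧ s ≤ x} = ∅ := by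
      refine Set.eq_empty_of_forall_notMem fun s hs => h2 ?_
      have h3 := Submodule.finrank_mono (le_inf hs.2.1 hs.2.2)
      have h4 := Submodule.finrank_lt_finrank_of_lt
        (lt_of_le_of_ne (inf_le_left : z ⊓ x ≤ z) fun h => h1 (inf_eq_left.1 h))
      have h5 := hs.1
      omega
    rw [this, Set.ncard_empty, Nat.cast_zero]

section Neighbors

variable {k : ℕ} {x z : Submodule F V}

/-- Sort the neighbours `y` by `h = x ∩ y`, a hyperplane of `x` above `z`. Each `h` has `[n - k +
1]` covers in `V`, one of which is `x`, leaving `[n - k + 1] - 1 = q [n - k]`. -/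
theorem ncard_neighbors_of_le [Finite F] (hx : finrank F x = k) (hz : z ≤ x) :
    ({y : Submodule F V | finrank F y = k ∧ finrank F (x ⊓ y : Submodule F V) + 1 = k ∧
      z ≤ y}.ncard : ℝ) = qBracket (Nat.card F) (k - finrank F z) *
        (Nat.card F * qBracket (Nat.card F) (finrank F V - k)) := by
  have : Finite (Submodule F V) := Submodule.finite_of_finite_field
  have h1 := Submodule.ncard_hyperplanes hz
  rw [hx] at h1
  rw [← h1]
  refine Set.ncard_eq_mul_of_fibers (f := fun y => x ⊓ y) (fun y hy => ?_) ?_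
  · exact ⟨hy.2.1, le_inf hz hy.2.2, inf_le_left⟩
  rintro h ⟨h2, h3, h4⟩
  have h5 := Submodule.ncard_covers (le_top : h ≤ ⊤)
  have hk : k ≤ finrank F V := hx ▸ Submodule.finrank_le x
  rw [finrank_top, h2, show finrank F V - finrank F h = finrank F V - k + 1 by omega] at h5
  rw [← qBracket_succ_sub_one Finite.one_lt_card, ← h5]
  have hxmem : x ∈ {U : Submodule F V | finrank F U = k ∧ h ≤ U ∧ U ≤ ⊤} := ⟨hx, h4, le_top⟩
  have h6 := Set.ncard_sdiff_singleton_add_one hxmem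
  rw [eq_sub_iff_add_eq, ← h6]
  push_cast
  congr 3
  ext y
  constructor
  · rintro ⟨⟨h7, h8, h9⟩, rfl⟩
    refine ⟨⟨h7, inf_le_right, le_top⟩, ?_⟩
    rintro rfl
    rw [inf_idem] at h8
    omega
  · rintro ⟨⟨h7, h8, -⟩, h9⟩
    have h10 : x ⊓ y < x := lt_of_le_of_ne inf_le_left fun h =>
      h9 (Submodule.eq_of_le_of_finrank_eq (inf_eq_left.1 h) (hx.trans h7.symm)).symm
    have h11 := Submodule.finrank_lt_finrank_of_lt h10
    have h12 : h = x ⊓ y := Submodule.eq_of_le_of_finrank_le (le_inf h4 h8) (by omega)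
    exact ⟨⟨h7, by rw [← h12]; exact h2, h3.trans h8⟩, h12.symm⟩

/-- The neighbour is determined by `h = x ∩ y`, a hyperplane of `x` above `z ∩ x`, through `y = h +
z`; the modular law gives `x ∩ (h + z) = h`. -/
theorem ncard_neighbors_of_finrank_inf [Finite F] (hx : finrank F x = k)
    (hz : finrank F (z ⊓ x : Submodule F V) + 1 = finrank F z) :
    ({y : Submodule F V | finrank F y = k ∧ finrank F (x ⊓ y : Submodule F V) + 1 = k ∧
      z ≤ y}.ncard : ℝ) =
        qBracket (Nat.card F) (k - finrank F (z ⊓ x : Submodule F V)) := by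
  have h1 := Submodule.ncard_hyperplanes (inf_le_right : z ⊓ x ≤ x)
  rw [hx] at h1
  have hmod : ∀ h, z ⊓ x ≤ h → h ≤ x → x ⊓ (h ⊔ z) = h := fun h h2 h3 => by
    rw [inf_comm, sup_inf_assoc_of_le z h3, sup_eq_left.2 h2]
  have hdim : ∀ h, z ⊓ x ≤ h → h ≤ x →
      finrank F (h ⊔ z : Submodule F V) = finrank F h + 1 := fun h h2 h3 => by
    have h4 := Submodule.finrank_sup_add_finrank_inf_eq h z
    rw [show h ⊓ z = z ⊓ x from le_antisymm (le_inf inf_le_right (inf_le_left.trans h3))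
      (le_inf h2 inf_le_left)] at h4
    omega
  rw [← h1]
  congr 1
  refine (Set.ncard_congr (fun h _ => h ⊔ z) ?_ ?_ ?_).symm
  · rintro h ⟨h2, h3, h4⟩
    refine ⟨(hdim h h3 h4).trans h2, ?_, le_sup_right⟩
    rw [hmod h h3 h4, h2]
  · rintro h h' ⟨-, h3, h4⟩ ⟨-, h3', h4'⟩ heq
    rw [← hmod h h3 h4, ← hmod h' h3' h4', show h ⊔ z = h' ⊔ z from heq]
  · rintro y ⟨h2, h3, h4⟩
    have h5 : z ⊓ x ≤ x ⊓ y := le_inf inf_le_right (inf_le_left.trans h4)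
    refine ⟨x ⊓ y, ⟨h3, h5, inf_le_left⟩, ?_⟩
    refine Submodule.eq_of_le_of_finrank_eq (sup_le inf_le_right h4) ?_
    rw [hdim _ h5 inf_le_left, h3, h2]

/-- Since `x ∩ y` is a hyperplane of `y ≥ z`, it meets `z` in codimension at most one, and `z ∩ (x ∩
y) = z ∩ x`. -/
theorem finrank_inf_add_one_eq_of_neighbor {y : Submodule F V} (hy : finrank F y = k)
    (hxy : finrank F (x ⊓ y : Submodule F V) + 1 = k) (hzy : z ≤ y) (hzx : ¬z ≤ x) :
    finrank F (z ⊓ x : Submodule F V) + 1 = finrank F z := by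
  have h1 := Submodule.finrank_sup_add_finrank_inf_eq z (x ⊓ y)
  rw [show z ⊓ (x ⊓ y) = z ⊓ x by rw [inf_comm x, ← inf_assoc, inf_eq_left.2 hzy]] at h1
  have h2 := Submodule.finrank_mono (sup_le hzy inf_le_right : z ⊔ x ⊓ y ≤ y)
  have h3 := Submodule.finrank_lt_finrank_of_lt
    (lt_of_le_of_ne (inf_le_left : z ⊓ x ≤ z) fun h => hzx (inf_eq_left.1 h))
  omega

-- As for the Johnson graph, `z ∩ x` of codimension one in `z` dictates `c_j`, and then `z ≤ x`,
-- with its `[j]` hyperplanes, dictates `θ_j`.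
open Classical in
theorem ncard_neighbors [Finite F] (hx : finrank F x = k) (hzk : finrank F z ≤ k) :
    ({y : Submodule F V | finrank F y = k ∧ finrank F (x ⊓ y : Submodule F V) + 1 = k ∧
      z ≤ y}.ncard : ℝ) =
      (Nat.card F * qBracket (Nat.card F) (k - finrank F z) *
          qBracket (Nat.card F) (finrank F V - k) -
        qBracket (Nat.card F) (finrank F z) * qBracket (Nat.card F) (k - finrank F z + 1)) *
        (if z ≤ x then 1 else 0) +
      qBracket (Nat.card F) (k - finrank F z + 1) *
        {s : Submodule F V | finrank F s + 1 = finrank F z ∧ s ≤ z ∧ s ≤ x}.ncard := by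
  rw [ncard_hyperplanes_le]
  split_ifs with h1 h2
  · rw [ncard_neighbors_of_le hx h1]
    ring
  · rw [ncard_neighbors_of_finrank_inf hx h2, show k - finrank F (z ⊓ x : Submodule F V) =
      k - finrank F z + 1 by omega]
    ring
  · have : {y : Submodule F V | finrank F y = k ∧
        finrank F (x ⊓ y : Submodule F V) + 1 = k ∧ z ≤ y} = ∅ :=
      Set.eq_empty_of_forall_notMem fun y hy =>
        h2 (finrank_inf_add_one_eq_of_neighbor hy.1 hy.2.1 hy.2.2 h1)
    rw [this]
    simp

end Neighbors

end Subspaces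

/-- The eigenvalue of the Grassmann graph on `V_j`. -/
noncomputable def grassmannEigenvalue (q n k j : ℕ) : ℝ :=
  q * qBracket q (k - j) * qBracket q (n - k) - qBracket q j * qBracket q (k - j + 1)

theorem grassmannEigenvalue_self {q : ℕ} (hq : 1 < q) (n k : ℕ) :
    grassmannEigenvalue q n k k = -qBracket q k := by
  have h : (q : ℝ) - 1 ≠ 0 := sub_ne_zero.2 (by exact_mod_cast hq.ne')
  simp [grassmannEigenvalue, qBracket, h]

theorem grassmannEigenvalue_succ {q : ℕ} (hq : 1 < q) {n k j : ℕ} (hk : 2 * k ≤ n)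
    (hj : j < k) : grassmannEigenvalue q n k j =
      grassmannEigenvalue q n k (j + 1) + qBracket q (n - 2 * j) * (q : ℝ) ^ j := by
  have h : (q : ℝ) - 1 ≠ 0 := sub_ne_zero.2 (by exact_mod_cast hq.ne')
  -- Writing `k = j + 1 + s` and `n = 2k + t` removes the truncated subtractions from the exponents,
  -- leaving a polynomial identity in powers of `q`.
  obtain ⟨s, rfl⟩ : ∃ s, k = j + 1 + s := ⟨k - (j + 1), by omega⟩
  obtain ⟨t, rfl⟩ : ∃ t, n = 2 * (j + 1 + s) + t := ⟨n - 2 * (j + 1 + s), by omega⟩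
  unfold grassmannEigenvalue qBracket
  rw [show j + 1 + s - j = s + 1 by omega, show j + 1 + s - (j + 1) = s by omega,
    show 2 * (j + 1 + s) + t - (j + 1 + s) = j + 1 + s + t by omega,
    show 2 * (j + 1 + s) + t - 2 * j = 2 * s + 2 + t by omega]
  field_simp
  ring

/-! ### The Grassmann graph -/

section Grassmann

open Module

variable {F V : Type*} [Field F] [AddCommGroup V] [Module F V] {k : ℕ}

theorem grassmannRank_eq_iff {z : GrassmannLattice F V k} {j : ℕ} (hj : j ≤ k) :
    grassmannRank F V k z = j ↔ finrank F z.1 = j := by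
  unfold grassmannRank
  split_ifs with h <;> omega

theorem ncard_grassmannLattice {j : ℕ} (hj : j ≤ k)
    (P : Submodule F V → Prop) :
    {z : GrassmannLattice F V k | grassmannRank F V k z = j ∧ P z.1}.ncard =
      {s : Submodule F V | finrank F s = j ∧ P s}.ncard := by
  rw [← Set.ncard_image_of_injective _ Subtype.val_injective]
  congr 1
  ext s
  simp only [grassmannRank_eq_iff hj]
  constructor
  · rintro ⟨z, hz, rfl⟩
    exact hz
  · intro hs
    exact ⟨⟨s, Or.inl (hs.1.le.trans hj)⟩, hs, rfl⟩

variable [Module.Finite F V]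

theorem finrank_inf_le_of_grassmannVertex (x y : GrassmannVertex F V k) :
    finrank F (x.1 ⊓ y.1 : Submodule F V) ≤ k :=
  (Submodule.finrank_mono inf_le_left).trans x.2.le

theorem eq_of_le_finrank_inf {x y : GrassmannVertex F V k}
    (h : k ≤ finrank F (x.1 ⊓ y.1 : Submodule F V)) : x = y := by
  have h1 : x.1 ⊓ y.1 = x.1 := Submodule.eq_of_le_of_finrank_le inf_le_left (x.2.le.trans h)
  have h2 : x.1 ⊓ y.1 = y.1 := Submodule.eq_of_le_of_finrank_le inf_le_right (y.2.le.trans h)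
  exact Subtype.ext (h1.symm.trans h2)

/-- Inside `z`, the hyperplane `x ∩ z` cuts `z ∩ y` in codimension at most one, and the result lies
in `x ∩ y`. -/
theorem finrank_inf_le_of_adj {x z : GrassmannVertex F V k} (h : (grassmannGraph F V k).Adj x z)
    (y : GrassmannVertex F V k) : finrank F (z.1 ⊓ y.1 : Submodule F V) ≤
      finrank F (x.1 ⊓ y.1 : Submodule F V) + 1 := by
  have h1 : finrank F (x.1 ⊓ z.1 : Submodule F V) + 1 = k := h
  have h2 := Submodule.finrank_sup_add_finrank_inf_eq (x.1 ⊓ z.1) (z.1 ⊓ y.1)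
  have h3 : finrank F ((x.1 ⊓ z.1) ⊔ (z.1 ⊓ y.1) : Submodule F V) ≤ k :=
    (Submodule.finrank_mono (sup_le inf_le_right inf_le_left)).trans z.2.le
  have h4 : finrank F ((x.1 ⊓ z.1) ⊓ (z.1 ⊓ y.1) : Submodule F V) ≤
      finrank F (x.1 ⊓ y.1 : Submodule F V) :=
    Submodule.finrank_mono (inf_le_inf inf_le_left inf_le_right)
  omega

theorem grassmannGraph_dist (x y : GrassmannVertex F V k) :
    (grassmannGraph F V k).dist x y = k - finrank F (x.1 ⊓ y.1 : Submodule F V) := by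
  refine SimpleGraph.dist_eq_of_adj_step
    (δ := fun x y : GrassmannVertex F V k => k - finrank F (x.1 ⊓ y.1 : Submodule F V))
    (fun x => ?_) (fun x y h => eq_of_le_finrank_inf (Nat.sub_eq_zero_iff_le.1 h))
    (fun x z y h => ?_) (fun x y h => ?_) x y
  · rw [inf_idem, x.2, Nat.sub_self]
  · have h1 := finrank_inf_le_of_adj h y
    omega
  -- One step towards `y`: keep a hyperplane `h'` of `x` containing `x ∩ y` and adjoin `v ∈ y \ x`.
  -- The intersection with `y` gains `v`, and by adjacency its dimension grows by no more than one.
  · obtain ⟨v, hvy, hvx⟩ : ∃ v ∈ y.1, v ∉ x.1 := by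
      by_contra! hle
      have h1 : x.1 ⊓ y.1 = y.1 := inf_eq_right.2 hle
      exact h (by rw [h1, y.2, Nat.sub_self])
    obtain ⟨h', h1, h2, h3⟩ := Submodule.exists_between_finrank_eq
      (inf_le_left : x.1 ⊓ y.1 ≤ x.1) (m := k - 1) (by omega) (by rw [x.2]; omega)
    have hvh : v ∉ h' := fun hv => hvx (h2 hv)
    have hvz : v ∈ h' ⊔ Submodule.span F {v} :=
      (le_sup_right : Submodule.span F {v} ≤ _) (Submodule.mem_span_singleton_self v)
    have hz : finrank F (h' ⊔ Submodule.span F {v} : Submodule F V) = k := by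
      rw [Submodule.finrank_sup_span_singleton_of_notMem hvh]
      omega
    let z : GrassmannVertex F V k := ⟨h' ⊔ Submodule.span F {v}, hz⟩
    have hadj : (grassmannGraph F V k).Adj x z := by
      have h4 := Submodule.finrank_mono (le_inf h2 le_sup_left : h' ≤ x.1 ⊓ z.1)
      have h5 : finrank F (x.1 ⊓ z.1 : Submodule F V) < k := by
        by_contra! hle
        have hxz := eq_of_le_finrank_inf hle
        exact hvx (hxz ▸ hvz)
      change finrank F (x.1 ⊓ z.1 : Submodule F V) + 1 = k
      omega
    have h6 := finrank_inf_le_of_adj hadj y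
    have h7 : x.1 ⊓ y.1 < z.1 ⊓ y.1 := lt_of_le_of_ne
      (le_inf (h1.trans le_sup_left) inf_le_right) fun h =>
        hvx (h.ge (Submodule.mem_inf.2 ⟨hvz, hvy⟩)).1
    have h8 := Submodule.finrank_lt_finrank_of_lt h7
    refine ⟨z, hadj, ?_⟩
    omega

theorem grassmann_latticeCounts [Finite F] (hk : 2 * k ≤ finrank F V) :
    LatticeCounts (grassmannGraph F V k) (grassmannCoatom F V k) (grassmannRank F V k) k
      (grassmannEigenvalue (Nat.card F) (finrank F V) k)
      (fun j => qBracket (Nat.card F) (k - j + 1)) (fun j => qBracket (Nat.card F) (k - j))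
      (fun j r => (subspaceCount F j r : ℝ)) where
  eq_of_dist_eq_zero x y h := by
    rw [grassmannGraph_dist, Nat.sub_eq_zero_iff_le] at h
    exact eq_of_le_finrank_inf h
  dist_le x y := by
    rw [grassmannGraph_dist]
    exact Nat.sub_le _ _
  exists_dist_eq := by
    obtain ⟨x, -, -, hx⟩ := Submodule.exists_between_finrank_eq (bot_le : (⊥ : Submodule F V) ≤ ⊤)
      (m := k) (by simp) (by rw [finrank_top]; omega)
    -- A complement of `x` has dimension `n - k ≥ k`, so it contains a vertex meeting `x` trivially.
    obtain ⟨x', hx'⟩ := x.exists_isCompl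
    have h1 := Submodule.finrank_add_eq_of_isCompl hx'
    obtain ⟨y, -, hy, hy'⟩ := Submodule.exists_between_finrank_eq (bot_le : ⊥ ≤ x')
      (m := k) (by simp) (by omega)
    refine ⟨⟨x, hx⟩, ⟨y, hy'⟩, ?_⟩
    rw [grassmannGraph_dist, (hx'.disjoint.mono_right hy).eq_bot, finrank_bot, Nat.sub_zero]
  card_neighbors z hz x := by
    classical
    have hcard : finrank F z.1 = grassmannRank F V k z := (grassmannRank_eq_iff hz).1 rfl
    simp only [SimpleGraph.dist_eq_one_iff_adj]
    have hw : {w : GrassmannLattice F V k | grassmannRank F V k w + 1 = grassmannRank F V k z ∧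
        w ≤ z ∧ w ≤ grassmannCoatom F V k x}.ncard =
        {s : Submodule F V | finrank F s + 1 = finrank F z.1 ∧ s ≤ z.1 ∧ s ≤ x.1}.ncard := by
      rw [hcard]
      rcases hr : grassmannRank F V k z with _ | j
      · simp
      · simp only [Nat.add_right_cancel_iff]
        exact ncard_grassmannLattice (by omega) (fun s => s ≤ z.1 ∧ s ≤ x.1)
    have hy : {y | (grassmannGraph F V k).Adj x y ∧ z ≤ grassmannCoatom F V k y}.ncard =
        {y : Submodule F V | finrank F y = k ∧ finrank F (x.1 ⊓ y : Submodule F V) + 1 = k ∧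
          z.1 ≤ y}.ncard := by
      rw [← Set.ncard_image_of_injective _ Subtype.val_injective]
      congr 1
      ext y
      constructor
      · rintro ⟨y, ⟨h1, h2⟩, rfl⟩
        exact ⟨y.2, h1, h2⟩
      · rintro ⟨h1, h2, h3⟩
        exact ⟨⟨y, h1⟩, ⟨h2, h3⟩, rfl⟩
    have hiota : latticeIota (grassmannCoatom F V k) z x = if z.1 ≤ x.1 then 1 else 0 :=
      latticeIota_eq_ite Iff.rfl
    rw [hw, hy, hiota, ← hcard]
    exact ncard_neighbors x.2 (hcard.le.trans hz)
  card_covers w x hw hwx := by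
    have hcard : finrank F w.1 = grassmannRank F V k w := (grassmannRank_eq_iff hw.le).1 rfl
    have h1 := ncard_grassmannLattice (k := k) (Nat.succ_le_of_lt hw)
      (fun s => w.1 ≤ s ∧ s ≤ x.1)
    have h2 := Submodule.ncard_covers (show w.1 ≤ x.1 from hwx)
    rw [hcard, x.2] at h2
    rw [← h2]
    exact congrArg Nat.cast h1
  card_common j hj x y := by
    have h1 := ncard_grassmannLattice hj (fun s => s ≤ x.1 ⊓ y.1)
    rw [ncard_finrank_eq_le] at h1
    rw [grassmannGraph_dist, Nat.sub_sub_self (finrank_inf_le_of_grassmannVertex x y), ← h1]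
    simp only [le_inf_iff]
    rfl
  common_of_lt j r h := by
    rw [subspaceCount_of_lt h, Nat.cast_zero]
  common_self j _ := by
    rw [subspaceCount_self, Nat.cast_one]
  c_ne_zero j _ := (qBracket_pos Finite.one_lt_card (Nat.succ_ne_zero _)).ne'
  m_ne_zero j hj := (qBracket_pos Finite.one_lt_card (by omega)).ne'
  succ_lt j hj := by
    have hq : 1 < Nat.card F := Finite.one_lt_card
    rw [grassmannEigenvalue_succ hq hk hj]
    have h1 := qBracket_pos hq (show finrank F V - 2 * j ≠ 0 by omega)
    have h2 : (0 : ℝ) < Nat.card F := by exact_mod_cast Nat.zero_lt_of_lt hq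
    have := mul_pos h1 (pow_pos h2 j)
    linarith

theorem grassmann_describesEigenspaces [Finite F] (hk : 2 * k ≤ finrank F V) : ∃ θ : ℕ → ℝ,
    LatticeDescribesEigenspaces (grassmannGraph F V k) (grassmannCoatom F V k)
      (grassmannRank F V k) k θ ∧
    θ k = -qBracket (Nat.card F) k ∧
    ∀ j < k, θ j = θ (j + 1) +
      qBracket (Nat.card F) (finrank F V - 2 * j) * (Nat.card F : ℝ) ^ j :=
  have : Finite (Submodule F V) := Submodule.finite_of_finite_field
  ⟨_, (grassmann_latticeCounts hk).describesEigenspaces,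
    grassmannEigenvalue_self Finite.one_lt_card _ _,
    fun _ hj => grassmannEigenvalue_succ Finite.one_lt_card hk hj⟩

end Grassmann

theorem theorem4p1 :
    -- the Johnson graph
    (∀ n k : ℕ, 2 * k ≤ n → ∃ θ : ℕ → ℝ,
      LatticeDescribesEigenspaces (johnsonGraph n k) (johnsonCoatom n k) (johnsonRank n k) k θ ∧
      θ k = -(k : ℝ) ∧
      ∀ j < k, θ j = θ (j + 1) + ((n : ℝ) - 2 * (j : ℝ))) ∧
    -- the Grassmann graph
    (∀ (F V : Type*) [Field F] [Finite F] [AddCommGroup V] [Module F V] [Module.Finite F V]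
      (q n k : ℕ), Nat.card F = q → Module.finrank F V = n → 2 * k ≤ n → ∃ θ : ℕ → ℝ,
      LatticeDescribesEigenspaces (grassmannGraph F V k) (grassmannCoatom F V k)
        (grassmannRank F V k) k θ ∧
      θ k = -qBracket q k ∧
      ∀ j < k, θ j = θ (j + 1) + qBracket q (n - 2 * j) * (q : ℝ) ^ j) ∧
    -- the hypercube
    (∀ n : ℕ, ∃ θ : ℕ → ℝ,
      LatticeDescribesEigenspaces (cubeGraph n) (cubeCoatom n) (cubeRank n) n θ ∧
      θ n = -(n : ℝ) ∧
      ∀ j < n, θ j = θ (j + 1) + 2) := by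
  refine ⟨fun n k hk => johnson_describesEigenspaces hk, ?_, cube_describesEigenspaces⟩
  rintro F V _ _ _ _ _ q n k rfl rfl hk
  exact grassmann_describesEigenspaces hk
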